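/- Conventions. A *periodic poset* (ppset) of degree $k>0$ is a partially ordered set $P$ with an action of $\mathbb{Z}^k$ by order preserving transformations (the shifts). It is *compact* if $\mathbb{Z}^k\backslash P$ is finite. A *map* $P\to Q$ of ppsets is an order preserving function commuting with the action of $(1,\dots,1)$; a *morphism* is an equivalence class of maps modulo precomposition with shifts of $P$ and postcomposition with shifts of $Q$, and $\operatorname{Hom}(P,Q)$ is the set of morphisms. Morphisms can be composed when the middle ppset has degree $1$. For $n\ge 0$ let $[[n]]$ be the degree $1$ ppset $\mathbb{Z}$ with generator acting by $x\mapsto x+n+1$. The cyclic category has objects $[[n]]$, $n\ge 0$, and all morphisms of ppsets between them; a *cyclic set* is a contravariant functor from it to sets, and products of cyclic sets are formed objectwise. The *cyclic realization* of a ppset $P$ is the cyclic set $\mathcal{C}(P)=\operatorname{Hom}(-,P)$. Let $S^1$ also denote the degree $1$ ppset $\mathbb{R}$ with generator $x\mapsto x+1$. For a ppset $P$, $||P||$ is the set of those morphisms $S^1\to P$ whose underlying maps are upper semicontinuous ($P$ being discrete: every $x\in\mathbb{R}$ has a neighbourhood on which $f\le f(x)$), with the topology of the (pseudo)metric $$d([f],[g])=\inf_{f'\in[f],\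 g'\in[g]}\ \lambda\{t\in[0,1]: f'(t)\ne g'(t)\},$$ where $\lambda$ is Lebesgue measure, and with the circle $\mathbb{R}/\mathbb{Z}$ acting by precomposition with translations. The *geometric realization* of a cyclic set $C$ is the colimit, in topological spaces with circle action, $$||C||=\varinjlim_{\mathcal{C}([[n]])\to C}||[[n]]||.$$ **Proposition.** Let $P$ and $Q$ be compact ppsets (of arbitrary, possibly different, degrees). Then $$||\mathcal{C}(P)\times\mathcal{C}(Q)||\cong||\mathcal{C}(P)||\times||\mathcal{C}(Q)||$$ as topological spaces with circle action, where the right hand side carries the product topology and the diagonal action. More precisely, the map induced by the two projections is a circle equivariant homeomorphism. -/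

import Mathlib

universe u v w

/-- A periodic partially ordered set (ppset): a poset with an order preserving action of `ℤ^k`,
where `k > 0` is the degree.  The action is written additively. -/
structure PPSet : Type (u + 1) where
  carrier : Type u
  [order : PartialOrder carrier]
  deg : ℕ
  deg_pos : 0 < deg
  [action : AddAction (Fin deg → ℤ) carrier]
  shift_mono : ∀ (a : Fin deg → ℤ) (x y : carrier), x ≤ y → a +ᵥ x ≤ a +ᵥ y

attribute [instance] PPSet.order PPSet.action

/-- A ppset is compact if it has finitely many orbits under its shifts. -/
def PPSet.IsCompact (P : PPSet.{u}) : Prop :=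
  Finite (AddAction.orbitRel.Quotient (Fin P.deg → ℤ) P.carrier)

/-- The standard ppset `[[n]]`: the ordered set `ℤ`, of degree one, whose generating shift is
translation by `n + 1`. -/
@[reducible]
noncomputable def PPSet.std (n : ℕ) : PPSet.{0} where
  carrier := ℤ
  deg := 1
  deg_pos := Nat.one_pos
  action :=
    { vadd := fun a x => x + a 0 * ((n : ℤ) + 1)
      zero_vadd := fun x => by
        change x + (0 : ℤ) * ((n : ℤ) + 1) = x
        ring
      add_vadd := fun a b x => by
        change x + (a 0 + b 0) * ((n : ℤ) + 1)
          = (x + b 0 * ((n : ℤ) + 1)) + a 0 * ((n : ℤ) + 1)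
        ring }
  shift_mono := fun a x y h => by
    change x + a 0 * ((n : ℤ) + 1) ≤ y + a 0 * ((n : ℤ) + 1)
    exact add_le_add_left h _

/-- The circle as a ppset: the ordered set `ℝ`, of degree one, whose generating shift is
translation by `1`. -/
@[reducible]
noncomputable def PPSet.circle : PPSet.{0} where
  carrier := ℝ
  deg := 1
  deg_pos := Nat.one_pos
  action :=
    { vadd := fun a x => x + (a 0 : ℝ)
      zero_vadd := fun x => by
        change x + ((0 : ℤ) : ℝ) = x
        simp
      add_vadd := fun a b x => by
        change x + ((a 0 + b 0 : ℤ) : ℝ) = (x + (b 0 : ℝ)) + (a 0 : ℝ)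
        push_cast
        ring }
  shift_mono := fun a x y h => by
    change x + (a 0 : ℝ) ≤ y + (a 0 : ℝ)
    exact add_le_add_left h _

/-- Maps of ppsets: order preserving functions commuting with `(1, …, 1)`. -/
@[ext]
structure PPMap (P : PPSet.{u}) (Q : PPSet.{v}) where
  toFun : P.carrier → Q.carrier
  mono : ∀ x y, x ≤ y → toFun x ≤ toFun y
  map_one : ∀ x, toFun ((1 : Fin P.deg → ℤ) +ᵥ x) = (1 : Fin Q.deg → ℤ) +ᵥ toFun x

/-- Two maps of ppsets are equivalent if they differ by precomposition with a shift of the source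
and postcomposition with a shift of the target. -/
def PPMap.setoid (P : PPSet.{u}) (Q : PPSet.{v}) : Setoid (PPMap P Q) where
  r f g := ∃ (a : Fin P.deg → ℤ) (b : Fin Q.deg → ℤ), ∀ x, g.toFun x = b +ᵥ f.toFun (a +ᵥ x)
  iseqv :=
    { refl := fun f => ⟨0, 0, fun x => by simp⟩
      symm := by
        rintro f g ⟨a, b, h⟩
        exact ⟨-a, -b, fun x => by rw [h]; simp⟩
      trans := by
        rintro f g k ⟨a, b, h⟩ ⟨a', b', h'⟩
        exact ⟨a + a', b' + b, fun x => by rw [h', h, add_vadd, add_vadd]⟩ }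

/-- Morphisms of ppsets: equivalence classes of maps. -/
def PPHom (P : PPSet.{u}) (Q : PPSet.{v}) : Type (max u v) := Quotient (PPMap.setoid P Q)

/-- The morphism represented by a map. -/
def PPHom.mk {P : PPSet.{u}} {Q : PPSet.{v}} (f : PPMap P Q) : PPHom P Q :=
  Quotient.mk (PPMap.setoid P Q) f

/-- The identity map. -/
def PPMap.id (P : PPSet.{u}) : PPMap P P := ⟨fun x => x, fun _ _ h => h, fun _ => rfl⟩

/-- Composition of maps: first `f`, then `g`. -/
def PPMap.comp {R : PPSet.{u}} {P : PPSet.{v}} {Q : PPSet.{w}} (f : PPMap R P) (g : PPMap P Q) :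
    PPMap R Q where
  toFun x := g.toFun (f.toFun x)
  mono x y h := g.mono _ _ (f.mono _ _ h)
  map_one x := by rw [f.map_one, g.map_one]

theorem PPMap.map_zsmul_one {P : PPSet.{u}} {Q : PPSet.{v}} (f : PPMap P Q) (n : ℤ)
    (x : P.carrier) :
    f.toFun ((n • (1 : Fin P.deg → ℤ)) +ᵥ x) = (n • (1 : Fin Q.deg → ℤ)) +ᵥ f.toFun x := by
  have key : ∀ (m : ℕ) (x : P.carrier),
      f.toFun ((m • (1 : Fin P.deg → ℤ)) +ᵥ x) = (m • (1 : Fin Q.deg → ℤ)) +ᵥ f.toFun x := by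
    intro m
    induction m with
    | zero => intro x; simp
    | succ m ih => intro x; rw [succ_nsmul, succ_nsmul, add_vadd, ih, f.map_one, add_vadd]
  obtain ⟨m, rfl | rfl⟩ := n.eq_nat_or_neg
  · simpa only [natCast_zsmul] using key m x
  · have h := key m ((-((m : ℤ) • (1 : Fin P.deg → ℤ))) +ᵥ x)
    rw [natCast_zsmul, vadd_neg_vadd] at h
    rw [neg_smul, neg_smul, natCast_zsmul, natCast_zsmul, h, neg_vadd_vadd]

/-- A map out of a ppset of degree one turns shifts into shifts. -/
theorem PPMap.map_shift {P : PPSet.{u}} {Q : PPSet.{v}} (hP : P.deg = 1) (f : PPMap P Q)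
    (a : Fin P.deg → ℤ) :
    ∃ b : Fin Q.deg → ℤ, ∀ x, f.toFun (a +ᵥ x) = b +ᵥ f.toFun x := by
  have ha : a = (a ⟨0, P.deg_pos⟩) • (1 : Fin P.deg → ℤ) := by
    funext i
    have hi : i = ⟨0, P.deg_pos⟩ := Fin.ext (by have := i.2; simp only []; omega)
    subst hi
    simp
  exact ⟨(a ⟨0, P.deg_pos⟩) • 1, fun x => by
    conv_lhs => rw [ha]
    exact f.map_zsmul_one _ x⟩

/-- Composition of morphisms, induced by composition of maps; it is well defined because the
intermediate ppset has degree one. -/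
def PPHom.comp {R : PPSet.{u}} {P : PPSet.{v}} {Q : PPSet.{w}} (hP : P.deg = 1)
    (f : PPHom R P) (g : PPHom P Q) : PPHom R Q :=
  Quotient.map₂ (sa := PPMap.setoid R P) (sb := PPMap.setoid P Q) (sc := PPMap.setoid R Q)
    PPMap.comp (by
      rintro f f' ⟨a, b, h⟩ g g' ⟨c, d, h'⟩
      obtain ⟨e, he⟩ := g.map_shift hP (c + b)
      refine ⟨a, d + e, fun x => ?_⟩
      change g'.toFun (f'.toFun x) = (d + e) +ᵥ g.toFun (f.toFun (a +ᵥ x))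
      rw [h', h, ← add_vadd, he, add_vadd]) f g

/-- The cyclic category: its objects are the standard ppsets `[[n]]`, its morphisms are all
morphisms of ppsets between them. -/
structure CycCat : Type where
  n : ℕ

/-- The ppset `[[n]]` corresponding to an object. -/
@[reducible]
noncomputable def CycCat.pp (a : CycCat) : PPSet.{0} := PPSet.std a.n

noncomputable instance : CategoryTheory.Category.{0} CycCat where
  Hom a b := PPHom a.pp b.pp
  id a := PPHom.mk (PPMap.id a.pp)
  comp f g := PPHom.comp rfl f g
  id_comp f := by
    induction f using Quotient.inductionOn
    rfl
  comp_id f := by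
    induction f using Quotient.inductionOn
    rfl
  assoc f g h := by
    induction f using Quotient.inductionOn
    induction g using Quotient.inductionOn
    induction h using Quotient.inductionOn
    rfl

/-- Cyclic sets: contravariant functors from the cyclic category to sets. -/
abbrev CyclicSet : Type (u + 1) := CategoryTheory.Functor (CycCatᵒᵖ) (Type u)

/-- The cyclic realization of a ppset `P`: the restriction to the cyclic category of the functor
represented by `P`. -/
noncomputable def PPSet.cyclic (P : PPSet.{u}) : CyclicSet.{u} where
  obj a := PPHom a.unop.pp P
  map θ := TypeCat.ofHom fun f => PPHom.comp rfl θ.unop f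
  map_id a := by
    ext f
    induction f using Quotient.inductionOn
    rfl
  map_comp θ η := by
    ext f
    induction f using Quotient.inductionOn with | h f => ?_
    obtain ⟨t, ht⟩ := Quotient.exists_rep θ.unop
    obtain ⟨s, hs⟩ := Quotient.exists_rep η.unop
    simp only [CategoryTheory.unop_comp, ← ht, ← hs]
    rfl

/-- Upper semicontinuity of a function on the line with values in a poset with the discrete
topology. -/
def PPMap.USC {P : PPSet.{u}} (f : PPMap PPSet.circle P) : Prop :=
  ∀ x : ℝ, ∀ᶠ y in nhds x, f.toFun y ≤ f.toFun x

/-- The underlying set of the geometric realization `‖P‖`: the morphisms from the circle to `P`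
which are represented by upper semicontinuous maps. -/
def Geo (P : PPSet.{u}) : Type u :=
  {c : PPHom PPSet.circle P // ∃ f : PPMap PPSet.circle P, PPHom.mk f = c ∧ f.USC}

/-- Equivalent maps out of the circle differ by a shift of the target. -/
theorem PPMap.exists_shift_of_mk_eq {P : PPSet.{u}} {f g : PPMap PPSet.circle P}
    (h : PPHom.mk f = PPHom.mk g) : ∃ b : Fin P.deg → ℤ, ∀ x, g.toFun x = b +ᵥ f.toFun x := by
  obtain ⟨a, b, hab⟩ := Quotient.exact h
  obtain ⟨e, he⟩ := f.map_shift rfl a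
  exact ⟨b + e, fun x => by rw [hab, he, add_vadd]⟩

/-- The measure of the set of points of the unit interval where two functions differ, that is,
the integral over the unit interval of the discrete distance between their values. -/
noncomputable def PPMap.diffVol {P : PPSet.{u}} (f g : PPMap PPSet.circle P) : ENNReal :=
  MeasureTheory.volume {t : ℝ | t ∈ Set.Icc (0 : ℝ) 1 ∧ f.toFun t ≠ g.toFun t}

/-- The distance on `‖P‖`: the infimum, over all maps representing the two given morphisms, of
`∫₀¹ d(f(t), g(t)) dt`, where `d` is the discrete metric on `P`. -/
noncomputable instance Geo.instPseudoEMetricSpace (P : PPSet.{u}) :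
    PseudoEMetricSpace (Geo P) where
  edist c d := ⨅ (f : PPMap PPSet.circle P) (g : PPMap PPSet.circle P)
    (_ : PPHom.mk f = c.1) (_ : PPHom.mk g = d.1), f.diffVol g
  edist_self c := by
    obtain ⟨f, hf, -⟩ := c.2
    refine le_antisymm ((iInf_le_of_le f <| iInf_le_of_le f <| iInf_le_of_le hf <|
      iInf_le_of_le hf ?_)) bot_le
    simp [PPMap.diffVol]
  edist_comm c d := by
    have key : ∀ c d : Geo P, (⨅ (f : PPMap PPSet.circle P) (g : PPMap PPSet.circle P)
        (_ : PPHom.mk f = c.1) (_ : PPHom.mk g = d.1), f.diffVol g) ≤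
        ⨅ (f : PPMap PPSet.circle P) (g : PPMap PPSet.circle P)
        (_ : PPHom.mk f = d.1) (_ : PPHom.mk g = c.1), f.diffVol g := by
      intro c d
      refine le_iInf fun f => le_iInf fun g => le_iInf fun hf => le_iInf fun hg => ?_
      refine iInf_le_of_le g <| iInf_le_of_le f <| iInf_le_of_le hg <| iInf_le_of_le hf ?_
      simp only [PPMap.diffVol, ne_comm, le_refl]
    exact le_antisymm (key c d) (key d c)
  edist_triangle c d e := by
    simp only [ENNReal.iInf_add, ENNReal.add_iInf]
    refine le_iInf fun g' => le_iInf fun k => le_iInf fun hg' => le_iInf fun hk => ?_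
    refine le_iInf fun f => le_iInf fun g => le_iInf fun hf => le_iInf fun hg => ?_
    obtain ⟨b, hb⟩ := PPMap.exists_shift_of_mk_eq (hg'.trans hg.symm)
    let k' : PPMap PPSet.circle P :=
      { toFun := fun x => b +ᵥ k.toFun x
        mono := fun x y h => P.shift_mono _ _ _ (k.mono _ _ h)
        map_one := fun x => by rw [k.map_one, vadd_comm] }
    have hk' : PPHom.mk k' = e.1 := by
      rw [← hk]
      exact (Quotient.sound (s := PPMap.setoid _ _) ⟨0, b, fun x => by simp [k']⟩).symm
    refine iInf_le_of_le f <| iInf_le_of_le k' <| iInf_le_of_le hf <| iInf_le_of_le hk' ?_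
    refine (MeasureTheory.measure_mono ?_).trans (MeasureTheory.measure_union_le _ _)
    rintro t ⟨ht, hne⟩
    by_cases h1 : f.toFun t = g.toFun t
    · refine Or.inr ⟨ht, fun h2 => hne ?_⟩
      rw [h1, hb, h2]
    · exact Or.inl ⟨ht, h1⟩

theorem Geo.edist_le {P : PPSet.{u}} (c d : Geo P) (f g : PPMap PPSet.circle P)
    (hf : PPHom.mk f = c.1) (hg : PPHom.mk g = d.1) : edist c d ≤ f.diffVol g :=
  iInf_le_of_le f <| iInf_le_of_le g <| iInf_le_of_le hf <| iInf_le_of_le hg le_rfl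

/-- Precomposition of a map with the translation of the line by `s`. -/
noncomputable def PPMap.translate {P : PPSet.{u}} (s : ℝ) (f : PPMap PPSet.circle P) : PPMap PPSet.circle P where
  toFun x := f.toFun ((x : ℝ) + s : ℝ)
  mono x y h := f.mono _ _ (add_le_add_left (show (x : ℝ) ≤ y from h) s)
  map_one x := by
    rw [← f.map_one]
    congr 1
    change (x + ((1 : ℤ) : ℝ)) + s = (x + s) + ((1 : ℤ) : ℝ)
    ring

theorem PPMap.USC.translate {P : PPSet.{u}} {f : PPMap PPSet.circle P} (hf : f.USC) (s : ℝ) :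
    (f.translate s).USC := fun x =>
  ((continuous_id.add continuous_const : Continuous fun y : ℝ => y + s).tendsto x).eventually
    (hf (x + s))

/-- Precomposition of a morphism with the translation of the line by `s`. -/
noncomputable def PPHom.translate {P : PPSet.{u}} (s : ℝ) (c : PPHom PPSet.circle P) : PPHom PPSet.circle P :=
  Quotient.map (sa := PPMap.setoid _ _) (sb := PPMap.setoid _ _) (PPMap.translate s) (by
    rintro f g ⟨a, b, h⟩
    refine ⟨a, b, fun x => ?_⟩
    change g.toFun ((x : ℝ) + s : ℝ) = b +ᵥ f.toFun ((x + (a 0 : ℝ)) + s : ℝ)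
    rw [h, show (x + (a 0 : ℝ)) + s = (x + s) + (a 0 : ℝ) by ring]
    rfl) c

/-- Precomposition with a translation, on `‖P‖`. -/
noncomputable def Geo.translate {P : PPSet.{u}} (s : ℝ) (c : Geo P) : Geo P :=
  ⟨c.1.translate s, by
    obtain ⟨f, hf, hu⟩ := c.2
    exact ⟨f.translate s, by rw [← hf]; rfl, hu.translate s⟩⟩

theorem Geo.translate_eq {P : PPSet.{u}} {r s : ℝ} (c : Geo P)
    (h : (r : UnitAddCircle) = (s : UnitAddCircle)) : c.translate r = c.translate s := by
  obtain ⟨n, hn⟩ := AddSubgroup.mem_zmultiples_iff.1 (QuotientAddGroup.eq.1 h)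
  apply Subtype.ext
  obtain ⟨f, hf, -⟩ := c.2
  change PPHom.translate r c.1 = PPHom.translate s c.1
  rw [← hf]
  refine Quotient.sound (s := PPMap.setoid _ _) ⟨fun _ => n, 0, fun x => ?_⟩
  change f.toFun ((x : ℝ) + s : ℝ) = (0 : Fin P.deg → ℤ) +ᵥ f.toFun ((x + (n : ℝ)) + r : ℝ)
  rw [zero_vadd]
  congr 1
  have : (n : ℝ) = -r + s := by simpa using hn
  rw [this]
  ring

/-- The circle action on `‖P‖`, by precomposition with translations of the line. -/
noncomputable instance Geo.instAddAction (P : PPSet.{u}) : AddAction UnitAddCircle (Geo P) where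
  vadd s c := Quotient.liftOn' s (fun r : ℝ => c.translate r)
    (fun _ _ h => Geo.translate_eq c (Quotient.sound' h))
  zero_vadd c := by
    obtain ⟨f, hf, -⟩ := c.2
    apply Subtype.ext
    change PPHom.translate 0 c.1 = c.1
    rw [← hf]
    exact congrArg PPHom.mk (PPMap.ext (funext fun x => congrArg f.toFun (add_zero (x : ℝ))))
  add_vadd s s' c := by
    induction s using QuotientAddGroup.induction_on with | H r => ?_
    induction s' using QuotientAddGroup.induction_on with | H r' => ?_
    obtain ⟨f, hf, -⟩ := c.2
    apply Subtype.ext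
    change PPHom.translate (r + r') c.1 = PPHom.translate r (PPHom.translate r' c.1)
    rw [← hf]
    exact congrArg PPHom.mk (PPMap.ext (funext fun x =>
      congrArg f.toFun (add_assoc (x : ℝ) r r').symm))

theorem Geo.coe_vadd {P : PPSet.{u}} (r : ℝ) (c : Geo P) :
    (r : UnitAddCircle) +ᵥ c = c.translate r := rfl

theorem PPMap.diffVol_translate_le {P : PPSet.{u}} (f g : PPMap PPSet.circle P) (s : ℝ) :
    (f.translate s).diffVol (g.translate s) ≤ 2 * f.diffVol g := by
  have hper : ∀ (h : PPMap PPSet.circle P) (m : ℤ) (t : ℝ),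
      h.toFun (t + m : ℝ) = (m • (1 : Fin P.deg → ℤ)) +ᵥ h.toFun t := by
    intro h m t
    rw [← h.map_zsmul_one]
    congr 1
    change t + (m : ℝ) = t + (((m • (1 : Fin 1 → ℤ)) 0 : ℤ) : ℝ)
    simp
  have hD : ∀ (m : ℤ) (t : ℝ), f.toFun (t + m : ℝ) ≠ g.toFun (t + m : ℝ) →
      f.toFun t ≠ g.toFun t := by
    intro m t h h'
    exact h (by rw [hper, hper, h'])
  set D : Set ℝ := {t : ℝ | t ∈ Set.Icc (0 : ℝ) 1 ∧ f.toFun t ≠ g.toFun t} with hDdef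
  have hsub : {t : ℝ | t ∈ Set.Icc (0 : ℝ) 1 ∧ (f.translate s).toFun t ≠ (g.translate s).toFun t}
      ⊆ ((fun t : ℝ => t + Int.fract s) ⁻¹' D) ∪ ((fun t : ℝ => t + (Int.fract s - 1)) ⁻¹' D) := by
    rintro t ⟨⟨h0, h1⟩, hne⟩
    have hne' : f.toFun (t + s : ℝ) ≠ g.toFun (t + s : ℝ) := hne
    have hfl := Int.floor_add_fract s
    have hf0 := Int.fract_nonneg s
    have hf1 := Int.fract_lt_one s
    rcases le_total (t + Int.fract s) 1 with hle | hle
    · left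
      refine ⟨⟨by positivity, hle⟩, hD ⌊s⌋ _ ?_⟩
      rwa [show t + Int.fract s + (⌊s⌋ : ℝ) = t + s by linarith]
    · right
      refine ⟨⟨by linarith, by linarith⟩, hD (⌊s⌋ + 1) _ ?_⟩
      push_cast
      rwa [show t + (Int.fract s - 1) + ((⌊s⌋ : ℝ) + 1) = t + s by linarith]
  refine (MeasureTheory.measure_mono hsub).trans ((MeasureTheory.measure_union_le _ _).trans ?_)
  rw [MeasureTheory.measure_preimage_add_right, MeasureTheory.measure_preimage_add_right, two_mul]
  rfl

theorem Geo.edist_vadd_le {P : PPSet.{u}} (r : ℝ) (c d : Geo P) :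
    edist ((r : UnitAddCircle) +ᵥ c) ((r : UnitAddCircle) +ᵥ d) ≤ 2 * edist c d := by
  change _ ≤ 2 * ⨅ (f : PPMap PPSet.circle P) (g : PPMap PPSet.circle P)
    (_ : PPHom.mk f = c.1) (_ : PPHom.mk g = d.1), f.diffVol g
  simp only [ENNReal.mul_iInf_of_ne two_ne_zero ENNReal.ofNat_ne_top]
  refine le_iInf fun f => le_iInf fun g => le_iInf fun hf => le_iInf fun hg => ?_
  refine (Geo.edist_le _ _ (f.translate r) (g.translate r) ?_ ?_).trans
    (PPMap.diffVol_translate_le f g r)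
  · change _ = PPHom.translate r c.1
    rw [← hf]
    rfl
  · change _ = PPHom.translate r d.1
    rw [← hg]
    rfl

theorem PPMap.USC.eventually_eq {P : PPSet.{u}} {f : PPMap PPSet.circle P} (hf : f.USC) (x : ℝ) :
    ∃ δ > 0, ∀ y : ℝ, x ≤ y → y < x + δ → f.toFun y = f.toFun x := by
  obtain ⟨δ, hδ, h⟩ := Metric.eventually_nhds_iff.1 (hf x)
  refine ⟨δ, hδ, fun y h1 h2 => le_antisymm (h ?_) (f.mono _ _ h1)⟩
  rw [Real.dist_eq, abs_of_nonneg (by linarith)]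
  linarith

theorem PPMap.USC.exists_diffVol_lt {P : PPSet.{u}} {f : PPMap PPSet.circle P} (hf : f.USC)
    {ε : ENNReal} (hε : 0 < ε) :
    ∃ δ > (0 : ℝ), ∀ s : ℝ, 0 ≤ s → s ≤ δ → (f.translate s).diffVol f < ε := by
  let A : ℝ → Set ℝ := fun s =>
    {t : ℝ | t ∈ Set.Icc (0 : ℝ) 1 ∧ (f.translate s).toFun t ≠ f.toFun t}
  have hmono : ∀ s s' : ℝ, 0 ≤ s → s ≤ s' → A s ⊆ A s' := by
    rintro s s' h0 hs t ⟨ht, hne⟩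
    refine ⟨ht, fun h => hne (le_antisymm ?_ ?_)⟩
    · rw [← h]
      exact f.mono (t + s : ℝ) (t + s' : ℝ) (add_le_add_right hs t)
    · exact f.mono t (t + s : ℝ) (show t ≤ t + s by linarith)
  have hmeas : ∀ s : ℝ, MeasurableSet (A s) := by
    intro s
    refine measurableSet_Icc.inter (MeasurableSet.of_mem_nhdsGT fun x hx => ?_)
    obtain ⟨δ, hδ, h⟩ := hf.eventually_eq x
    obtain ⟨δ', hδ', h'⟩ := (hf.translate s).eventually_eq x
    refine mem_nhdsGT_iff_exists_Ioo_subset.2 ⟨x + min δ δ', by simp [hδ, hδ'], fun y hy => ?_⟩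
    have h3 := min_le_left δ δ'
    have h4 := min_le_right δ δ'
    change (f.translate s).toFun y ≠ f.toFun y
    rw [h y hy.1.le (by linarith [hy.2]), h' y hy.1.le (by linarith [hy.2])]
    exact hx
  have hT := MeasureTheory.tendsto_measure_iInter_atTop (μ := MeasureTheory.volume)
    (s := fun n : ℕ => A (1 / ((n : ℝ) + 1))) (fun n => (hmeas _).nullMeasurableSet)
    (fun m n hmn => hmono _ _ (by positivity) (one_div_le_one_div_of_le (by positivity)
      (by gcongr)))
    ⟨0, ((MeasureTheory.measure_mono (fun t ht => ht.1)).trans_lt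
      (measure_Icc_lt_top (a := (0 : ℝ)) (b := 1))).ne⟩
  have hempty : ⋂ n : ℕ, A (1 / ((n : ℝ) + 1)) = ∅ := by
    refine Set.eq_empty_of_forall_notMem fun t ht => ?_
    obtain ⟨δ, hδ, h⟩ := hf.eventually_eq t
    obtain ⟨n, hn⟩ := exists_nat_one_div_lt hδ
    refine (Set.mem_iInter.1 ht n).2 (h _ ?_ ?_)
    · have : (0 : ℝ) ≤ 1 / ((n : ℝ) + 1) := by positivity
      linarith
    · linarith
  rw [hempty, MeasureTheory.measure_empty] at hT
  obtain ⟨n, hn⟩ := (hT.eventually (gt_mem_nhds hε)).exists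
  exact ⟨1 / ((n : ℝ) + 1), by positivity, fun s h0 hs =>
    (MeasureTheory.measure_mono (hmono _ _ h0 hs)).trans_lt hn⟩

theorem Geo.tendsto_vadd_self {P : PPSet.{u}} (c : Geo P) :
    Filter.Tendsto (fun r : ℝ => edist ((r : UnitAddCircle) +ᵥ c) c) (nhds 0) (nhds 0) := by
  rw [ENNReal.tendsto_nhds_zero]
  intro ε hε
  obtain ⟨f, hf, hu⟩ := c.2
  obtain ⟨δ, hδ, h⟩ := hu.exists_diffVol_lt (ε := ε / 2) (ENNReal.half_pos hε.ne')
  have h1 : ∀ s : ℝ, 0 ≤ s → s ≤ δ → edist ((s : UnitAddCircle) +ᵥ c) c ≤ ε / 2 := by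
    intro s h0 hs
    refine (Geo.edist_le _ _ (f.translate s) f ?_ hf).trans (h s h0 hs).le
    change _ = PPHom.translate s c.1
    rw [← hf]
    rfl
  filter_upwards [Metric.ball_mem_nhds (0 : ℝ) hδ] with r hr
  have hr' : |r| < δ := by simpa [Real.dist_eq] using hr
  obtain ⟨hr1, hr2⟩ := abs_lt.1 hr'
  rcases le_total 0 r with h0 | h0
  · exact (h1 r h0 hr2.le).trans ENNReal.half_le_self
  · have h2 := Geo.edist_vadd_le r (((-r : ℝ) : UnitAddCircle) +ᵥ c) c
    rw [← add_vadd, ← AddCircle.coe_add, add_neg_cancel, AddCircle.coe_zero, zero_vadd,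
      edist_comm] at h2
    refine h2.trans ((mul_le_mul_right (h1 (-r) (by linarith) (by linarith)) 2).trans ?_)
    rw [ENNReal.mul_div_cancel two_ne_zero ENNReal.ofNat_ne_top]

/-- `‖P‖` is a space with a circle action: the action is continuous. -/
instance Geo.instContinuousVAdd (P : PPSet.{u}) : ContinuousVAdd UnitAddCircle (Geo P) where
  continuous_vadd := by
    have hq : Topology.IsQuotientMap
        (Prod.map (QuotientAddGroup.mk : ℝ → UnitAddCircle) (id : Geo P → Geo P)) :=
      (QuotientAddGroup.isOpenQuotientMap_mk.prodMap IsOpenQuotientMap.id).isQuotientMap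
    rw [hq.continuous_iff, continuous_iff_continuousAt]
    rintro ⟨r₀, c₀⟩
    have hT : Filter.Tendsto
        (fun p : ℝ × Geo P => 2 * edist p.2 c₀ +
          edist (((p.1 - r₀ : ℝ) : UnitAddCircle) +ᵥ ((r₀ : UnitAddCircle) +ᵥ c₀))
            ((r₀ : UnitAddCircle) +ᵥ c₀))
        (nhds (r₀, c₀)) (nhds 0) := by
      have h1 : Filter.Tendsto (fun p : ℝ × Geo P => 2 * edist p.2 c₀) (nhds (r₀, c₀))
          (nhds (2 * 0)) := by
        refine ENNReal.Tendsto.const_mul ?_ (Or.inr ENNReal.ofNat_ne_top)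
        have := (continuous_snd.edist continuous_const :
          Continuous fun p : ℝ × Geo P => edist p.2 c₀).tendsto (r₀, c₀)
        simpa using this
      have h2 := (Geo.tendsto_vadd_self ((r₀ : UnitAddCircle) +ᵥ c₀)).comp
        (Continuous.tendsto' (f := fun p : ℝ × Geo P => p.1 - r₀) (by fun_prop) (r₀, c₀) 0
          (sub_self r₀))
      simpa using h1.add h2
    refine tendsto_iff_edist_tendsto_0.2 (tendsto_of_tendsto_of_tendsto_of_le_of_le
      tendsto_const_nhds hT (fun _ => bot_le) ?_)
    rintro ⟨r, c⟩
    refine (edist_triangle _ ((r : UnitAddCircle) +ᵥ c₀) _).trans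
      (add_le_add (Geo.edist_vadd_le r c c₀) (le_of_eq ?_))
    rw [← add_vadd, ← AddCircle.coe_add, sub_add_cancel]
    rfl

/-- Functoriality of the geometric realization: a morphism `θ` sends `c` to the composite of `c`
and `θ`. -/
noncomputable def Geo.map {P : PPSet.{u}} {Q : PPSet.{v}} (hP : P.deg = 1) (θ : PPHom P Q)
    (c : Geo P) : Geo Q :=
  ⟨PPHom.comp hP c.1 θ, by
    obtain ⟨f, hf, hu⟩ := c.2
    induction θ using Quotient.inductionOn with | h θ => ?_
    refine ⟨f.comp θ, by rw [← hf]; rfl, fun x => ?_⟩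
    filter_upwards [hu x] with y hy using θ.mono _ _ hy⟩

theorem Geo.map_vadd {P : PPSet.{u}} {Q : PPSet.{v}} (hP : P.deg = 1) (θ : PPHom P Q)
    (s : UnitAddCircle) (c : Geo P) : Geo.map hP θ (s +ᵥ c) = s +ᵥ Geo.map hP θ c := by
  induction s using QuotientAddGroup.induction_on with | H r => ?_
  induction θ using Quotient.inductionOn with | h θ => ?_
  obtain ⟨f, hf, -⟩ := c.2
  apply Subtype.ext
  change PPHom.comp hP (PPHom.translate r c.1) _ = PPHom.translate r (PPHom.comp hP c.1 _)
  rw [← hf]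
  rfl

/-- The disjoint union of the spaces `‖[[n]]‖`, indexed by the maps from the standard cyclic
simplex of dimension `n` to `C`.  By the Yoneda lemma these maps are the elements of `C([[n]])`. -/
abbrev CyclicSet.PreRealization (C : CyclicSet.{u}) : Type u :=
  Σ p : (Σ a : CycCat, C.obj (Opposite.op a)), Geo p.1.pp

/-- The identifications made in the colimit: for every morphism `θ : [[m]] ⟶ [[n]]` and every
`x` in `C([[n]])`, the space `‖[[m]]‖` with index `θ^* x` maps to the space `‖[[n]]‖` with index
`x` by `θ`. -/
inductive CyclicSet.Rel (C : CyclicSet.{u}) : C.PreRealization → C.PreRealization → Prop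
  | glue {a b : CycCat} (θ : a ⟶ b) (x : C.obj (Opposite.op b)) (c : Geo a.pp) :
      CyclicSet.Rel C ⟨⟨a, C.map θ.op x⟩, c⟩ ⟨⟨b, x⟩, Geo.map rfl θ c⟩

/-- The geometric realization `‖C‖` of a cyclic set: the colimit of the spaces `‖[[n]]‖` over the
category of maps from standard cyclic simplices to `C`.  The colimit of spaces with a circle action
is the colimit of the underlying spaces, that is, a quotient of the disjoint union, with the
induced action. -/
def CyclicSet.Realization (C : CyclicSet.{u}) : Type u := Quot C.Rel

instance CyclicSet.Realization.instTopologicalSpace (C : CyclicSet.{u}) :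
    TopologicalSpace C.Realization :=
  inferInstanceAs (TopologicalSpace (Quot C.Rel))

/-- The circle action on `‖C‖`, induced by the actions on the spaces `‖[[n]]‖`. -/
noncomputable instance CyclicSet.Realization.instAddAction (C : CyclicSet.{u}) :
    AddAction UnitAddCircle C.Realization where
  vadd s := Quot.map (fun z => ⟨z.1, s +ᵥ z.2⟩) (by
    rintro _ _ ⟨θ, x, c⟩
    simp only [← Geo.map_vadd]
    exact CyclicSet.Rel.glue θ x _)
  zero_vadd := by
    rintro ⟨p, c⟩
    exact congrArg (Quot.mk _) (Sigma.ext rfl (heq_of_eq (zero_vadd _ c)))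
  add_vadd s s' := by
    rintro ⟨p, c⟩
    exact congrArg (Quot.mk _) (Sigma.ext rfl (heq_of_eq (add_vadd s s' c)))

/-- `‖C‖` is a space with a circle action: the action is continuous. -/
instance CyclicSet.Realization.instContinuousVAdd (C : CyclicSet.{u}) :
    ContinuousVAdd UnitAddCircle C.Realization where
  continuous_vadd := by
    let F : C.Realization → ContinuousMap UnitAddCircle C.Realization := fun z =>
      { toFun := fun s => s +ᵥ z
        continuous_toFun := by
          obtain ⟨p, c⟩ := z
          exact continuous_quot_mk.comp (continuous_sigmaMk.comp
            (continuous_id.vadd continuous_const :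
              Continuous fun s : UnitAddCircle => s +ᵥ c)) }
    have hF : Continuous F := by
      refine isQuotientMap_quot_mk.continuous_iff.2 (continuous_sigma fun p => ?_)
      refine ContinuousMap.continuous_of_continuous_uncurry _ ?_
      exact continuous_quot_mk.comp (continuous_sigmaMk.comp
        (continuous_snd.vadd continuous_fst :
          Continuous fun q : Geo p.1.pp × UnitAddCircle => q.2 +ᵥ q.1))
    exact (ContinuousMap.continuous_uncurry_of_continuous ⟨F, hF⟩).comp continuous_swap

/-- The map of geometric realizations induced by a map of cyclic sets. -/
def CyclicSet.Realization.map {C D : CyclicSet.{u}} (φ : C ⟶ D) : C.Realization → D.Realization :=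
  Quot.map (fun z => ⟨⟨z.1.1, φ.app (Opposite.op z.1.1) z.1.2⟩, z.2⟩) (by
    rintro _ _ ⟨θ, x, c⟩
    have h : φ.app _ (C.map θ.op x) = D.map θ.op (φ.app _ x) :=
      CategoryTheory.NatTrans.naturality_apply φ θ.op x
    have g := CyclicSet.Rel.glue (C := D) θ (φ.app _ x) c
    rw [← h] at g
    exact g)

/-- The product of cyclic sets, formed objectwise. -/
noncomputable abbrev CyclicSet.prod (C D : CyclicSet.{u}) : CyclicSet.{u} :=
  CategoryTheory.FunctorToTypes.prod C D

/-- The projection to the first factor. -/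
noncomputable abbrev CyclicSet.fst (C D : CyclicSet.{u}) : C.prod D ⟶ C :=
  CategoryTheory.FunctorToTypes.prod.fst

/-- The projection to the second factor. -/
noncomputable abbrev CyclicSet.snd (C D : CyclicSet.{u}) : C.prod D ⟶ D :=
  CategoryTheory.FunctorToTypes.prod.snd

/-! A point of `‖𝒞(P)‖` is represented by a simplex `x : [[n]] → P` and an upper semicontinuous `c :
S¹ → [[n]]`. The key construction is a common refinement. Given `c : S¹ → [[n]]` and `c' : S¹ →
[[n']]`, the pointwise sum `c + c'` is a map to `[[n + n' + 1]]` that jumps wherever `c` or `c'`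
does. Both therefore factor through it, by sampling them at its jumps
(`Geo.exists_common_refinement`). If `f ∘ c` and `f' ∘ c'` agree up to a shift, so do their samples.
Hence a point of `‖𝒞(P)‖` is determined by its composite `S¹ → P`. This makes the comparison map
injective, and refining one representative from each factor makes it surjective. Neither argument
needs compactness of `P` or `Q`.

The inverse must also be continuous. Each `‖[[n]]‖` is compact, being a continuous image of a
compact space of jump sequences, and it is Hausdorff. There are finitely many morphisms `[[N]] →
[[n]]`. So for each pair of simplices, `‖[[n]]‖ × ‖[[n']]‖` is a quotient of a finite disjoint union
of copies of `‖[[n + n' + 1]]‖`, on which the inverse is visibly continuous.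

These pieces must then be assembled, although a product of quotient maps need not be a quotient map.
Compactness of `P` and `Q` gives countably many simplices, so the disjoint unions are σ-compact and
locally compact. The refinement argument shows that the kernels of the quotient maps are closed.
Under these conditions the product is a quotient map
(`Topology.IsQuotientMap.prodMap_of_isClosed_kernel`). -/

/-! ### Products of quotient maps -/

/-- If the kernel of `q` is closed, the saturation of a compact set is closed. -/
theorem isClosed_preimage_image_of_isCompact {X : Type*} {Y : Type*} [TopologicalSpace X]
    {q : X → Y} (hR : IsClosed {p : X × X | q p.1 = q p.2}) {A : Set X} (hA : IsCompact A) :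
    IsClosed (q ⁻¹' (q '' A)) := by
  have : CompactSpace A := isCompact_iff_compactSpace.1 hA
  have h : IsClosed {p : A × X | q p.1 = q p.2} :=
    hR.preimage (f := fun p : A × X => ((p.1 : X), p.2)) (by fun_prop)
  -- The saturation is the projection to `X` of a closed set of pairs, along the compact factor `A`.
  convert isClosedMap_snd_of_compactSpace _ h
  ext y
  simp

/-- One step of the construction in `Topology.IsQuotientMap.prodMap_of_isClosed_kernel`. -/
theorem exists_compact_saturating_prod {X X' Y Y' : Type*} [TopologicalSpace X]
    [TopologicalSpace X'] [LocallyCompactSpace X] [LocallyCompactSpace X']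
    {q : X → Y} {q' : X' → Y'}
    (hR : IsClosed {p : X × X | q p.1 = q p.2}) (hR' : IsClosed {p : X' × X' | q' p.1 = q' p.2})
    {W : Set (Y × Y')} (hW : IsOpen (Prod.map q q' ⁻¹' W))
    {A K : Set X} {A' K' : Set X'} (hA : IsCompact A) (hA' : IsCompact A') (hK : IsCompact K)
    (hK' : IsCompact K') (hAW : A ×ˢ A' ⊆ Prod.map q q' ⁻¹' W) :
    ∃ (B : Set X) (B' : Set X'), IsCompact B ∧ IsCompact B' ∧ A ⊆ interior B ∧
      A' ⊆ interior B' ∧ K ∩ q ⁻¹' (q '' A) ⊆ B ∧ K' ∩ q' ⁻¹' (q' '' A') ⊆ B' ∧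
      B ×ˢ B' ⊆ Prod.map q q' ⁻¹' W := by
  have hC := hA.union (hK.inter_right (isClosed_preimage_image_of_isCompact hR hA))
  have hC' := hA'.union (hK'.inter_right (isClosed_preimage_image_of_isCompact hR' hA'))
  -- The preimage of `W` is saturated in each variable, so enlarging `A` and `A'` inside their
  -- saturations does not leave it.
  have hsub : (A ∪ K ∩ q ⁻¹' (q '' A)) ×ˢ (A' ∪ K' ∩ q' ⁻¹' (q' '' A')) ⊆
      Prod.map q q' ⁻¹' W := by
    have h1 : A ∪ K ∩ q ⁻¹' (q '' A) ⊆ q ⁻¹' (q '' A) :=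
      Set.union_subset (Set.subset_preimage_image _ _) Set.inter_subset_right
    have h2 : A' ∪ K' ∩ q' ⁻¹' (q' '' A') ⊆ q' ⁻¹' (q' '' A') :=
      Set.union_subset (Set.subset_preimage_image _ _) Set.inter_subset_right
    rintro ⟨x, x'⟩ ⟨hx, hx'⟩
    obtain ⟨a, ha, hax⟩ := h1 hx
    obtain ⟨a', ha', hax'⟩ := h2 hx'
    have := hAW (Set.mk_mem_prod ha ha')
    simp only [Set.mem_preimage, Prod.map_apply] at this ⊢
    simp only at hax hax'
    rwa [← hax, ← hax']
  obtain ⟨V, V', hV, hV', hCV, hCV', hVW⟩ := generalized_tube_lemma hC hC' hW hsub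
  obtain ⟨B, hB, hCB, hBV⟩ := exists_compact_between hC hV hCV
  obtain ⟨B', hB', hCB', hBV'⟩ := exists_compact_between hC' hV' hCV'
  exact ⟨B, B', hB, hB', Set.subset_union_left.trans hCB, Set.subset_union_left.trans hCB',
    (Set.subset_union_right.trans hCB).trans interior_subset,
    (Set.subset_union_right.trans hCB').trans interior_subset,
    (Set.prod_mono hBV hBV').trans hVW⟩

/-- An increasing union of sets, each contained in the interior of the next one and containing
the trace of the saturation of the previous one on a compact covering, has an open image. -/
theorem Topology.IsQuotientMap.isOpen_image_iUnion {X Y : Type*} [TopologicalSpace X]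
    [TopologicalSpace Y] [SigmaCompactSpace X] {q : X → Y} (hq : Topology.IsQuotientMap q)
    {A : ℕ → Set X} (hA : ∀ n, A n ⊆ interior (A (n + 1)))
    (hs : ∀ n, compactCovering X n ∩ q ⁻¹' (q '' A n) ⊆ A (n + 1)) :
    IsOpen (q '' ⋃ n, A n) := by
  have hmono : Monotone A := monotone_nat_of_le_succ fun n => (hA n).trans interior_subset
  rw [← hq.isOpen_preimage]
  have : q ⁻¹' (q '' ⋃ n, A n) = ⋃ n, A n := by
    refine (Set.subset_preimage_image _ _).antisymm' ?_
    rintro y ⟨x, hx, hxy⟩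
    obtain ⟨n, hn⟩ := Set.mem_iUnion.1 hx
    obtain ⟨m, hm⟩ := exists_mem_compactCovering y
    -- At stage `max m n` the compact covering already contains `y` and `A` already contains `x`, so
    -- the next stage absorbs `y`.
    exact Set.mem_iUnion.2 ⟨max m n + 1, hs _
      ⟨compactCovering_subset X (le_max_left _ _) hm, x, hmono (le_max_right _ _) hn, hxy⟩⟩
  rw [this, isOpen_iff_mem_nhds]
  intro x hx
  obtain ⟨n, hn⟩ := Set.mem_iUnion.1 hx
  exact Filter.mem_of_superset (mem_interior_iff_mem_nhds.1 (hA n hn))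
    (Set.subset_iUnion A (n + 1))

/-- The product of two quotient maps with closed kernels from locally compact, σ-compact spaces
is a quotient map. -/
theorem Topology.IsQuotientMap.prodMap_of_isClosed_kernel {X X' Y Y' : Type*}
    [TopologicalSpace X] [TopologicalSpace X'] [TopologicalSpace Y] [TopologicalSpace Y']
    [LocallyCompactSpace X] [LocallyCompactSpace X'] [SigmaCompactSpace X] [SigmaCompactSpace X']
    {q : X → Y} {q' : X' → Y'} (hq : Topology.IsQuotientMap q) (hq' : Topology.IsQuotientMap q')
    (hR : IsClosed {p : X × X | q p.1 = q p.2})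
    (hR' : IsClosed {p : X' × X' | q' p.1 = q' p.2}) :
    Topology.IsQuotientMap (Prod.map q q') := by
  refine (Topology.isQuotientMap_iff _).2 ⟨Topology.isCoinducing_iff.2 fun W =>
    ⟨fun hW => ?_, fun h => h.preimage (hq.continuous.prodMap hq'.continuous)⟩,
    hq.surjective.prodMap hq'.surjective⟩
  rw [isOpen_iff_mem_nhds]
  rintro ⟨y, y'⟩ hy
  obtain ⟨x, rfl⟩ := hq.surjective y
  obtain ⟨x', rfl⟩ := hq'.surjective y'
  let S := {A : Set X × Set X' //
    IsCompact A.1 ∧ IsCompact A.2 ∧ A.1 ×ˢ A.2 ⊆ Prod.map q q' ⁻¹' W}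
  have step : ∀ (n : ℕ) (A : S), ∃ B : S, A.1.1 ⊆ interior B.1.1 ∧ A.1.2 ⊆ interior B.1.2 ∧
      compactCovering X n ∩ q ⁻¹' (q '' A.1.1) ⊆ B.1.1 ∧
      compactCovering X' n ∩ q' ⁻¹' (q' '' A.1.2) ⊆ B.1.2 := by
    rintro n ⟨⟨A, A'⟩, hA, hA', hAW⟩
    obtain ⟨B, B', h1, h2, h3, h4, h5, h6, h7⟩ := exists_compact_saturating_prod hR hR' hW hA hA'
      (isCompact_compactCovering X n) (isCompact_compactCovering X' n) hAW
    exact ⟨⟨⟨B, B'⟩, h1, h2, h7⟩, h3, h4, h5, h6⟩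
  choose F hF1 hF2 hF3 hF4 using step
  -- Both sequences grow simultaneously, keeping the rectangles inside the preimage of `W`. The
  -- images of the two unions are then open and span a rectangle inside `W`.
  let A : ℕ → S := Nat.rec ⟨({x}, {x'}), isCompact_singleton, isCompact_singleton, by
    simpa [Set.singleton_prod_singleton] using hy⟩ F
  have hU := hq.isOpen_image_iUnion (A := fun n => (A n).1.1) (fun n => hF1 n (A n))
    (fun n => hF3 n (A n))
  have hU' := hq'.isOpen_image_iUnion (A := fun n => (A n).1.2) (fun n => hF2 n (A n))
    (fun n => hF4 n (A n))
  have hmono : Monotone fun n => (A n).1.1 :=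
    monotone_nat_of_le_succ fun n => (hF1 n (A n)).trans interior_subset
  have hmono' : Monotone fun n => (A n).1.2 :=
    monotone_nat_of_le_succ fun n => (hF2 n (A n)).trans interior_subset
  refine Filter.mem_of_superset (prod_mem_nhds
    (hU.mem_nhds ⟨x, Set.mem_iUnion.2 ⟨0, rfl⟩, rfl⟩)
    (hU'.mem_nhds ⟨x', Set.mem_iUnion.2 ⟨0, rfl⟩, rfl⟩)) ?_
  rintro ⟨_, _⟩ ⟨⟨a, ha, rfl⟩, ⟨a', ha', rfl⟩⟩
  obtain ⟨n, hn⟩ := Set.mem_iUnion.1 ha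
  obtain ⟨m, hm⟩ := Set.mem_iUnion.1 ha'
  exact (A (max n m)).2.2.2
    (Set.mk_mem_prod (hmono (le_max_left n m) hn) (hmono' (le_max_right n m) hm))

theorem Sigma.locallyCompactSpace {ι : Type*} {X : ι → Type*} [∀ i, TopologicalSpace (X i)]
    [∀ i, LocallyCompactSpace (X i)] : LocallyCompactSpace (Σ i, X i) where
  local_compact_nhds := by
    rintro ⟨i, x⟩ n hn
    rw [Sigma.nhds_mk] at hn
    obtain ⟨s, hs, hsn, hsc⟩ := LocallyCompactSpace.local_compact_nhds x _ hn
    refine ⟨Sigma.mk i '' s, ?_, Set.image_subset_iff.2 hsn, hsc.image continuous_sigmaMk⟩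
    rw [Sigma.nhds_mk]
    exact Filter.image_mem_map hs

/-- A function on a product of two disjoint unions is continuous if its restrictions to the
products of the pieces are. -/
theorem continuous_sigma_prod_sigma {ι κ Z : Type*} {X : ι → Type*} {Y : κ → Type*}
    [∀ i, TopologicalSpace (X i)] [∀ j, TopologicalSpace (Y j)] [TopologicalSpace Z]
    {f : (Σ i, X i) × (Σ j, Y j) → Z}
    (h : ∀ i j, Continuous fun p : X i × Y j => f (⟨i, p.1⟩, ⟨j, p.2⟩)) : Continuous f := by
  rw [continuous_iff_continuousAt]
  rintro ⟨⟨i, x⟩, ⟨j, y⟩⟩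
  have he : Topology.IsOpenEmbedding (Prod.map (Sigma.mk i : X i → Σ i, X i)
      (Sigma.mk j : Y j → Σ j, Y j)) := .prodMap .sigmaMk .sigmaMk
  exact (he.continuousAt_iff (g := f) (x := (x, y))).1 (h i j).continuousAt

/-! ### Jumps of maps from the circle to `[[n]]` -/

theorem PPMap.toFun_add_one {P : PPSet.{u}} (f : PPMap PPSet.circle P) (x : ℝ) :
    f.toFun (x + 1 : ℝ) = (1 : Fin P.deg → ℤ) +ᵥ f.toFun x := by
  rw [← f.map_one]
  congr 1
  change x + 1 = x + ((1 : ℤ) : ℝ)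
  simp

theorem PPMap.std_toFun_add_int {n : ℕ} (f : PPMap PPSet.circle (PPSet.std n)) (x : ℝ) (k : ℤ) :
    (f.toFun (x + k : ℝ) : ℤ) = (f.toFun x : ℤ) + k * (n + 1) := by
  have h := f.map_zsmul_one k x
  change f.toFun (x + ((k * 1 : ℤ) : ℝ)) = (f.toFun x : ℤ) + (k * 1) * ((n : ℤ) + 1) at h
  simpa using h

theorem PPMap.std_mono_real {n : ℕ} (f : PPMap PPSet.circle (PPSet.std n)) {x y : ℝ} (h : x ≤ y) :
    (f.toFun x : ℤ) ≤ (f.toFun y : ℤ) := f.mono x y h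

/-- The point where a map from the circle to `[[n]]` jumps to a value `≥ m`. -/
noncomputable def PPMap.jump {n : ℕ} (f : PPMap PPSet.circle (PPSet.std n)) (m : ℤ) : ℝ :=
  sInf {x : ℝ | m ≤ (f.toFun x : ℤ)}

theorem PPMap.exists_le_std {n : ℕ} (f : PPMap PPSet.circle (PPSet.std n)) (m : ℤ) :
    ∃ x : ℝ, m ≤ (f.toFun x : ℤ) := by
  -- Each period raises the value by `n + 1 ≥ 1`, so `|m - f 0|` periods suffice.
  refine ⟨((0 : ℝ) + (|m - (f.toFun (0 : ℝ) : ℤ)| : ℤ) : ℝ), ?_⟩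
  rw [f.std_toFun_add_int]
  have := le_abs_self (m - (f.toFun (0 : ℝ) : ℤ))
  have := abs_nonneg (m - (f.toFun (0 : ℝ) : ℤ))
  nlinarith [(Nat.cast_nonneg n : (0 : ℤ) ≤ n)]

theorem PPMap.exists_std_lt {n : ℕ} (f : PPMap PPSet.circle (PPSet.std n)) (m : ℤ) :
    ∃ x : ℝ, (f.toFun x : ℤ) < m := by
  refine ⟨((0 : ℝ) + (-(|m - (f.toFun (0 : ℝ) : ℤ)| + 1) : ℤ) : ℝ), ?_⟩
  rw [f.std_toFun_add_int]
  have := neg_abs_le (m - (f.toFun (0 : ℝ) : ℤ))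
  have := abs_nonneg (m - (f.toFun (0 : ℝ) : ℤ))
  nlinarith [(Nat.cast_nonneg n : (0 : ℤ) ≤ n)]

/-- Upper semicontinuity and monotonicity make `f` locally constant to the right, so the infimum
defining the jump is attained. The resulting Galois connection translates between `f` and its jumps.
-/
theorem PPMap.USC.le_toFun_iff {n : ℕ} {f : PPMap PPSet.circle (PPSet.std n)} (hf : f.USC)
    (m : ℤ) (x : ℝ) : m ≤ (f.toFun x : ℤ) ↔ f.jump m ≤ x := by
  have hb : BddBelow {x : ℝ | m ≤ (f.toFun x : ℤ)} := by
    obtain ⟨y, hy⟩ := f.exists_std_lt m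
    refine ⟨y, fun x hx => ?_⟩
    by_contra! h
    exact absurd (f.std_mono_real h.le) (not_le.2 (hy.trans_le hx))
  refine ⟨fun h => csInf_le hb h, fun h => ?_⟩
  obtain ⟨δ, hδ, he⟩ := hf.eventually_eq (f.jump m)
  have hj : m ≤ (f.toFun (f.jump m) : ℤ) := by
    obtain ⟨y, hy, hyd⟩ := exists_lt_of_csInf_lt (f.exists_le_std m)
      (show f.jump m < f.jump m + δ by linarith)
    rw [← he y (csInf_le hb hy) hyd]
    exact hy
  exact hj.trans (f.std_mono_real h)

theorem PPMap.USC.jump_add {n : ℕ} {f : PPMap PPSet.circle (PPSet.std n)} (hf : f.USC)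
    (m k : ℤ) : f.jump (m + k * (n + 1)) = f.jump m + k := by
  refine eq_of_forall_ge_iff fun x => ?_
  have := f.std_toFun_add_int (x - k) k
  rw [sub_add_cancel] at this
  rw [← hf.le_toFun_iff, ← le_sub_iff_add_le (b := (k : ℝ)), ← hf.le_toFun_iff, this,
    add_le_add_iff_right]

theorem PPMap.USC.jump_mono {n : ℕ} {f : PPMap PPSet.circle (PPSet.std n)} (hf : f.USC) :
    Monotone f.jump := fun m k h => by
  rw [← hf.le_toFun_iff]
  exact h.trans ((hf.le_toFun_iff k _).2 le_rfl)

/-! ### Common refinements -/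

/-- The sum of two maps from the circle to standard ppsets. -/
noncomputable def PPMap.add {n n' : ℕ} (c : PPMap PPSet.circle (PPSet.std n))
    (c' : PPMap PPSet.circle (PPSet.std n')) : PPMap PPSet.circle (PPSet.std (n + n' + 1)) where
  toFun x := ((c.toFun x : ℤ) + (c'.toFun x : ℤ) : ℤ)
  mono x y h := add_le_add (α := ℤ) (c.mono x y h) (c'.mono x y h)
  map_one x := by
    have h : (c.toFun (x + ((1 : ℤ) : ℝ)) : ℤ) = (c.toFun x : ℤ) + 1 * ((n : ℤ) + 1) :=
      c.map_one x
    have h' : (c'.toFun (x + ((1 : ℤ) : ℝ)) : ℤ) = (c'.toFun x : ℤ) + 1 * ((n' : ℤ) + 1) :=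
      c'.map_one x
    -- The periods add up: `(n + 1) + (n' + 1) = (n + n' + 1) + 1`.
    change (c.toFun (x + ((1 : ℤ) : ℝ)) : ℤ) + (c'.toFun (x + ((1 : ℤ) : ℝ)) : ℤ) =
      (c.toFun x : ℤ) + (c'.toFun x : ℤ) + 1 * (((n + n' + 1 : ℕ) : ℤ) + 1)
    rw [h, h']
    push_cast
    ring

theorem PPMap.USC.add {n n' : ℕ} {c : PPMap PPSet.circle (PPSet.std n)}
    {c' : PPMap PPSet.circle (PPSet.std n')} (hc : c.USC) (hc' : c'.USC) : (c.add c').USC := by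
  intro x
  filter_upwards [hc x, hc' x] with y h h' using add_le_add (α := ℤ) h h'

/-- Sampling `c` at the jumps of `s`. -/
noncomputable def PPMap.sample {n N : ℕ} {s : PPMap PPSet.circle (PPSet.std N)} (hs : s.USC)
    (c : PPMap PPSet.circle (PPSet.std n)) : PPMap (PPSet.std N) (PPSet.std n) where
  toFun m := c.toFun (s.jump m)
  mono x y h := c.mono _ _ (hs.jump_mono h)
  map_one m := by
    change c.toFun (s.jump (m + 1 * ((N : ℤ) + 1))) = _
    rw [hs.jump_add, Int.cast_one, c.toFun_add_one]

/-- The jump of `s` at the value `s x` is the left endpoint of the level set of `s` through `x`. A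
map constant on the level sets of `s` is thus recovered from its samples. -/
theorem PPMap.comp_sample {n N : ℕ} {s : PPMap PPSet.circle (PPSet.std N)} (hs : s.USC)
    (c : PPMap PPSet.circle (PPSet.std n))
    (h : ∀ x y : ℝ, x ≤ y → s.toFun x = s.toFun y → c.toFun x = c.toFun y) :
    s.comp (PPMap.sample hs c) = c := by
  ext x
  change c.toFun (s.jump (s.toFun x)) = c.toFun x
  have h1 : s.jump (s.toFun x) ≤ x := (hs.le_toFun_iff _ _).1 le_rfl
  have h2 : (s.toFun x : ℤ) ≤ s.toFun (s.jump (s.toFun x)) := (hs.le_toFun_iff _ _).2 le_rfl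
  exact h _ _ h1 (le_antisymm (s.std_mono_real h1) h2)

theorem PPMap.comp_sample_add_left {n n' : ℕ} {c : PPMap PPSet.circle (PPSet.std n)}
    {c' : PPMap PPSet.circle (PPSet.std n')} (hc : c.USC) (hc' : c'.USC) :
    (c.add c').comp (PPMap.sample (hc.add hc') c) = c := by
  refine PPMap.comp_sample _ _ fun x y h hs => ?_
  have h1 := c.std_mono_real h
  have h2 := c'.std_mono_real h
  have h3 : (c.toFun x : ℤ) + (c'.toFun x : ℤ) = (c.toFun y : ℤ) + (c'.toFun y : ℤ) := hs
  -- Two nondecreasing functions whose sum does not change cannot change individually.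
  exact le_antisymm h1 (by linarith)

theorem PPMap.comp_sample_add_right {n n' : ℕ} {c : PPMap PPSet.circle (PPSet.std n)}
    {c' : PPMap PPSet.circle (PPSet.std n')} (hc : c.USC) (hc' : c'.USC) :
    (c.add c').comp (PPMap.sample (hc.add hc') c') = c' := by
  refine PPMap.comp_sample _ _ fun x y h hs => ?_
  have h1 := c.std_mono_real h
  have h2 := c'.std_mono_real h
  have h3 : (c.toFun x : ℤ) + (c'.toFun x : ℤ) = (c.toFun y : ℤ) + (c'.toFun y : ℤ) := hs
  exact le_antisymm h2 (by linarith)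

/-- Two points of `‖[[n]]‖` and `‖[[n']]‖` have a common refinement `s` in `‖[[n + n' + 1]]‖`,
which moreover detects all coincidences of their images in other ppsets. -/
theorem Geo.exists_common_refinement {n n' : ℕ} (c : Geo (PPSet.std n))
    (c' : Geo (PPSet.std n')) :
    ∃ (s : Geo (PPSet.std (n + n' + 1))) (θ : PPHom (PPSet.std (n + n' + 1)) (PPSet.std n))
      (θ' : PPHom (PPSet.std (n + n' + 1)) (PPSet.std n')),
      Geo.map rfl θ s = c ∧ Geo.map rfl θ' s = c' ∧
      ∀ (P : PPSet.{u}) (f : PPHom (PPSet.std n) P) (f' : PPHom (PPSet.std n') P),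
        PPHom.comp rfl c.1 f = PPHom.comp rfl c'.1 f' →
          PPHom.comp rfl θ f = PPHom.comp rfl θ' f' := by
  obtain ⟨_, c, rfl, hc⟩ := c
  obtain ⟨_, c', rfl, hc'⟩ := c'
  refine ⟨⟨PPHom.mk (c.add c'), _, rfl, hc.add hc'⟩, PPHom.mk (PPMap.sample (hc.add hc') c),
    PPHom.mk (PPMap.sample (hc.add hc') c'), ?_, ?_, fun P f f' h => ?_⟩
  · exact Subtype.ext (congrArg PPHom.mk (PPMap.comp_sample_add_left hc hc'))
  · exact Subtype.ext (congrArg PPHom.mk (PPMap.comp_sample_add_right hc hc'))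
  · induction f using Quotient.inductionOn with | h f => ?_
    induction f' using Quotient.inductionOn with | h f' => ?_
    -- One shift `b` relates the composites at every real point, in particular at the jumps of `c +
    -- c'`, where the samples are taken.
    obtain ⟨b, hb⟩ := PPMap.exists_shift_of_mk_eq (f := c.comp f) (g := c'.comp f') h
    refine Quotient.sound (s := PPMap.setoid _ _) ⟨0, b, fun m => ?_⟩
    rw [zero_vadd]
    exact hb _

/-! ### Continuity of induced maps and compactness of `‖[[n]]‖` -/

/-- Composing with `θ` can only shrink the set where two representatives differ, so the induced map
is 1-Lipschitz. -/
theorem Geo.continuous_map {P : PPSet.{u}} {Q : PPSet.{v}} (hP : P.deg = 1) (θ : PPHom P Q) :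
    Continuous (Geo.map hP θ) := by
  refine (LipschitzWith.of_edist_le fun c d => ?_ : LipschitzWith 1 (Geo.map hP θ)).continuous
  induction θ using Quotient.inductionOn with | h θ => ?_
  refine le_iInf fun f => le_iInf fun g => le_iInf fun hf => le_iInf fun hg => ?_
  refine (Geo.edist_le _ _ (f.comp θ) (g.comp θ) (by change _ = PPHom.comp hP c.1 _; rw [← hf]; rfl)
    (by change _ = PPHom.comp hP d.1 _; rw [← hg]; rfl)).trans (MeasureTheory.measure_mono ?_)
  rintro t ⟨ht, hne⟩
  exact ⟨ht, fun h => hne (congrArg θ.toFun h)⟩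

/-- The possible sequences of jumps of upper semicontinuous maps from the circle to `[[n]]`. -/
def jumpSequences (n : ℕ) : Set (ℤ → ℝ) :=
  {t | Monotone t ∧ (∀ i, t (i + (n + 1)) = t i + 1) ∧ t 0 ∈ Set.Icc (0 : ℝ) 1}

theorem jumpSequences.apply_shift {n : ℕ} {t : ℤ → ℝ} (ht : t ∈ jumpSequences n) (i k : ℤ) :
    t (i + k * (n + 1)) = t i + k := by
  have hper : ∀ i, t (i + (n + 1)) = t i + 1 := ht.2.1
  induction k using Int.induction_on with
  | zero => simp
  | succ k ih => rw [add_mul, one_mul, ← add_assoc, hper, ih]; push_cast; ring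
  | pred k ih =>
    have := hper (i + (-(k : ℤ) - 1) * (n + 1))
    rw [show i + (-(k : ℤ) - 1) * (n + 1) + (n + 1) = i + -(k : ℤ) * (n + 1) by ring, ih] at this
    push_cast at this ⊢
    linarith

/-- The defining conditions are closed in the product topology. Monotonicity, periodicity and the
normalization of `t 0` confine each `t i` to `[-|i|, |i| + 1]`, so Tychonoff's theorem applies. -/
theorem isCompact_jumpSequences (n : ℕ) : IsCompact (jumpSequences n) := by
  refine (isCompact_univ_pi fun i : ℤ => isCompact_Icc (a := -|(i : ℝ)|)
    (b := |(i : ℝ)| + 1)).of_isClosed_subset ?_ ?_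
  · refine IsClosed.inter ?_ (IsClosed.inter ?_ ?_)
    · have : {t : ℤ → ℝ | Monotone t} = ⋂ (i : ℤ) (j : ℤ) (_ : i ≤ j), {t | t i ≤ t j} := by
        ext t; simp [Monotone]
      change IsClosed {t : ℤ → ℝ | Monotone t}
      rw [this]
      exact isClosed_iInter fun i => isClosed_iInter fun j => isClosed_iInter fun _ =>
        isClosed_le (continuous_apply i) (continuous_apply j)
    · have : {t : ℤ → ℝ | ∀ i, t (i + (n + 1)) = t i + 1} =
          ⋂ i : ℤ, {t | t (i + (n + 1)) = t i + 1} := by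
        ext t; simp
      change IsClosed {t : ℤ → ℝ | ∀ i, t (i + (n + 1)) = t i + 1}
      rw [this]
      exact isClosed_iInter fun i => isClosed_eq (by fun_prop) (by fun_prop)
    · exact isClosed_Icc.preimage (continuous_apply (0 : ℤ))
  · intro t ht i _
    have h1 := jumpSequences.apply_shift ht 0 |i|
    have h2 := jumpSequences.apply_shift ht 0 (-|i|)
    have h3 : t i ≤ t (0 + |i| * (n + 1)) := ht.1 (by nlinarith [le_abs_self i, abs_nonneg i])
    have h4 : t (0 + -|i| * (n + 1)) ≤ t i := ht.1 (by nlinarith [neg_abs_le i, abs_nonneg i])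
    have h5 := ht.2.2.1
    have h6 := ht.2.2.2
    push_cast at h1 h2
    constructor <;> linarith

theorem jumpSequences.exists_floor {n : ℕ} {t : ℤ → ℝ} (ht : t ∈ jumpSequences n) (x : ℝ) :
    ∃ k : ℤ, ∀ m, m ≤ k ↔ t m ≤ x := by
  obtain ⟨k, hk, hk'⟩ := Int.exists_greatest_of_bdd (P := fun m => t m ≤ x)
    ⟨(⌊x⌋ + 1) * (n + 1), fun m hm => by
      by_contra! h
      have h1 := ht.1 h.le
      rw [← zero_add ((⌊x⌋ + 1) * ((n : ℤ) + 1)), jumpSequences.apply_shift ht] at h1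
      have h2 := Int.lt_floor_add_one x
      have h3 := ht.2.2.1
      push_cast at h1
      linarith⟩
    ⟨0 + (⌊x⌋ - 1) * (n + 1), by
      have h2 := Int.floor_le x
      have h3 := ht.2.2.2
      rw [jumpSequences.apply_shift ht]
      push_cast
      linarith⟩
  exact ⟨k, fun m => ⟨fun h => (ht.1 h).trans hk, hk' m⟩⟩

/-- The map from the circle to `[[n]]` with a given sequence of jumps. -/
noncomputable def PPMap.ofJumps {n : ℕ} (t : jumpSequences n) :
    PPMap PPSet.circle (PPSet.std n) where
  toFun x := Classical.choose (jumpSequences.exists_floor t.2 x)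
  mono x y h := by
    have hx := Classical.choose_spec (jumpSequences.exists_floor t.2 x)
    have hy := Classical.choose_spec (jumpSequences.exists_floor t.2 y)
    exact (hy _).2 (((hx _).1 le_rfl).trans h)
  map_one x := by
    have hx := Classical.choose_spec (jumpSequences.exists_floor t.2 x)
    have hy := Classical.choose_spec (jumpSequences.exists_floor t.2 (x + ((1 : ℤ) : ℝ)))
    change Classical.choose (jumpSequences.exists_floor t.2 (x + ((1 : ℤ) : ℝ))) =
      Classical.choose (jumpSequences.exists_floor t.2 x) + 1 * ((n : ℤ) + 1)
    refine eq_of_forall_le_iff fun m => ?_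
    have h := jumpSequences.apply_shift t.2 m (-1)
    have h' : ∀ z : ℤ, m ≤ z + 1 * ((n : ℤ) + 1) ↔ m + -1 * ((n : ℤ) + 1) ≤ z := fun z => by
      constructor <;> intro <;> linarith
    rw [hy, h', hx, h]
    push_cast
    rw [← sub_eq_add_neg, sub_le_iff_le_add]

theorem PPMap.le_ofJumps_iff {n : ℕ} (t : jumpSequences n) (m : ℤ) (x : ℝ) :
    m ≤ ((PPMap.ofJumps t).toFun x : ℤ) ↔ t.1 m ≤ x :=
  Classical.choose_spec (jumpSequences.exists_floor t.2 x) m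

theorem PPMap.USC.ofJumps {n : ℕ} (t : jumpSequences n) : (PPMap.ofJumps t).USC := by
  intro x
  have h : x < t.1 (((PPMap.ofJumps t).toFun x : ℤ) + 1) := by
    rw [← not_le, ← PPMap.le_ofJumps_iff]
    exact not_le.2 (lt_add_one _)
  filter_upwards [gt_mem_nhds h] with y hy
  change ((PPMap.ofJumps t).toFun y : ℤ) ≤ ((PPMap.ofJumps t).toFun x : ℤ)
  rw [← Int.lt_add_one_iff, ← not_le, PPMap.le_ofJumps_iff]
  exact not_le.2 hy

/-- The point of `‖[[n]]‖` with a given sequence of jumps. -/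
noncomputable def Geo.ofJumps {n : ℕ} (t : jumpSequences n) : Geo (PPSet.std n) :=
  ⟨PPHom.mk (PPMap.ofJumps t), _, rfl, .ofJumps t⟩

theorem Geo.surjective_ofJumps (n : ℕ) :
    Function.Surjective (Geo.ofJumps : jumpSequences n → Geo (PPSet.std n)) := by
  rintro ⟨_, f, rfl, hf⟩
  -- Translating by an integer, which is a shift of the circle, brings jump `0` into `[0, 1)`.
  let t : jumpSequences n := ⟨fun m => f.jump m - ⌊f.jump 0⌋, fun _ _ h =>
    sub_le_sub_right (hf.jump_mono h) _, fun i => by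
      have := hf.jump_add i 1
      rw [one_mul, Int.cast_one] at this
      change f.jump (i + (n + 1)) - _ = f.jump i - _ + 1
      rw [this]
      ring, by
      have h1 := Int.floor_le (f.jump 0)
      have h2 := Int.lt_floor_add_one (f.jump 0)
      constructor <;> linarith⟩
  refine ⟨t, Subtype.ext (Quotient.sound (s := PPMap.setoid _ _) ?_)⟩
  refine ⟨fun _ => -⌊f.jump 0⌋, 0, fun x => ?_⟩
  rw [zero_vadd]
  change (f.toFun x : ℤ) = ((PPMap.ofJumps t).toFun (x + ((-⌊f.jump 0⌋ : ℤ) : ℝ)) : ℤ)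
  refine eq_of_forall_le_iff fun m => ?_
  rw [hf.le_toFun_iff, PPMap.le_ofJumps_iff]
  push_cast
  change _ ↔ f.jump m - _ ≤ _
  rw [← sub_eq_add_neg, sub_le_sub_iff_right]

/-- Since `t 0` lies in `[0, 1]`, jump `-(n + 1)` is at most `0` and jump `2 * (n + 1)` exceeds `1`.
Only finitely many jumps therefore matter on the unit interval. -/
theorem PPMap.ofJumps_mem_Icc {n : ℕ} (t : jumpSequences n) {x : ℝ} (hx : x ∈ Set.Icc (0 : ℝ) 1) :
    ((PPMap.ofJumps t).toFun x : ℤ) ∈ Set.Icc (-((n : ℤ) + 1)) (2 * (n + 1)) := by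
  have h1 := jumpSequences.apply_shift t.2 0 (-1)
  have h2 := jumpSequences.apply_shift t.2 0 2
  have h3 := t.2.2.2.1
  have h4 := t.2.2.2.2
  have h5 := hx.1
  have h6 := hx.2
  push_cast at h1 h2
  constructor
  · rw [PPMap.le_ofJumps_iff, show -((n : ℤ) + 1) = 0 + -1 * (n + 1) by ring, h1]
    linarith
  · by_contra! h
    have := (PPMap.le_ofJumps_iff t _ _).1 h.le
    rw [show (2 * ((n : ℤ) + 1)) = 0 + 2 * (n + 1) by ring, h2] at this
    linarith

theorem PPMap.diffVol_ofJumps_le {n : ℕ} (t u : jumpSequences n) :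
    (PPMap.ofJumps t).diffVol (PPMap.ofJumps u) ≤
      ∑ i ∈ Finset.Icc (-((n : ℤ) + 1)) (2 * (n + 1)), ENNReal.ofReal |u.1 i - t.1 i| := by
  simp only [← Real.volume_interval]
  refine (MeasureTheory.measure_mono ?_).trans (MeasureTheory.measure_biUnion_finset_le _ _)
  rintro x ⟨hx, hne⟩
  have key : ∀ t u : jumpSequences n,
      ((PPMap.ofJumps u).toFun x : ℤ) < ((PPMap.ofJumps t).toFun x : ℤ) →
      ∃ i ∈ Finset.Icc (-((n : ℤ) + 1)) (2 * (n + 1)), x ∈ Set.Icc (t.1 i) (u.1 i) := by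
    intro t u h
    -- The index is the larger of the two values: `t` has already made that jump by `x`, and `u` has
    -- not.
    refine ⟨((PPMap.ofJumps t).toFun x : ℤ), Finset.mem_Icc.2 (PPMap.ofJumps_mem_Icc t hx),
      (PPMap.le_ofJumps_iff t _ _).1 le_rfl, ?_⟩
    by_contra! h'
    exact absurd ((PPMap.le_ofJumps_iff u _ _).2 h'.le) (not_le.2 h)
  simp only [Set.mem_iUnion]
  rcases lt_or_gt_of_ne (a := ((PPMap.ofJumps t).toFun x : ℤ)) hne with h | h
  · obtain ⟨i, hi, hxi⟩ := key u t h
    exact ⟨i, hi, Set.Icc_subset_uIcc' hxi⟩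
  · obtain ⟨i, hi, hxi⟩ := key t u h
    exact ⟨i, hi, Set.Icc_subset_uIcc hxi⟩

theorem Geo.continuous_ofJumps (n : ℕ) :
    Continuous (Geo.ofJumps : jumpSequences n → Geo (PPSet.std n)) := by
  rw [continuous_iff_continuousAt]
  intro t
  refine tendsto_iff_edist_tendsto_0.2 (tendsto_of_tendsto_of_tendsto_of_le_of_le
    tendsto_const_nhds ?_ (fun _ => bot_le) fun u =>
      (Geo.edist_le _ _ _ _ rfl rfl).trans (PPMap.diffVol_ofJumps_le u t))
  refine Continuous.tendsto' (continuous_finsetSum _ fun i _ =>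
    ENNReal.continuous_ofReal.comp (continuous_const.sub
      ((continuous_apply i).comp continuous_subtype_val)).abs) _ _ (by simp)

instance Geo.compactSpace_std (n : ℕ) : CompactSpace (Geo (PPSet.std n)) := by
  have := isCompact_iff_compactSpace.1 (isCompact_jumpSequences n)
  exact (Geo.surjective_ofJumps n).compactSpace (Geo.continuous_ofJumps n)

/-! ### Hausdorffness of `‖[[n]]‖` -/

/-- With representatives fixed, the infimum defining the distance runs only over the relative shift
`k` of the target. -/
theorem Geo.exists_volume_lt {n : ℕ} {c d : Geo (PPSet.std n)}
    {f g : PPMap PPSet.circle (PPSet.std n)}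
    (hf : PPHom.mk f = c.1) (hg : PPHom.mk g = d.1) {ε : ENNReal} (h : edist c d < ε) :
    ∃ k : ℤ, MeasureTheory.volume {t : ℝ | t ∈ Set.Icc (0 : ℝ) 1 ∧
      (f.toFun t : ℤ) ≠ (g.toFun t : ℤ) + k * (n + 1)} < ε := by
  change (⨅ (f : PPMap PPSet.circle (PPSet.std n)) (g : PPMap PPSet.circle (PPSet.std n))
    (_ : PPHom.mk f = c.1) (_ : PPHom.mk g = d.1), f.diffVol g) < ε at h
  simp only [iInf_lt_iff] at h
  obtain ⟨f', g', hf', hg', h⟩ := h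
  obtain ⟨a, ha⟩ := PPMap.exists_shift_of_mk_eq (hf.trans hf'.symm)
  obtain ⟨b, hb⟩ := PPMap.exists_shift_of_mk_eq (hg.trans hg'.symm)
  refine ⟨b 0 - a 0, lt_of_le_of_lt (MeasureTheory.measure_mono ?_) h⟩
  rintro t ⟨ht, hne⟩
  refine ⟨ht, fun he => hne ?_⟩
  have h1 : (f'.toFun t : ℤ) = (f.toFun t : ℤ) + a 0 * ((n : ℤ) + 1) := ha t
  have h2 : (g'.toFun t : ℤ) = (g.toFun t : ℤ) + b 0 * ((n : ℤ) + 1) := hb t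
  rw [h1, h2] at he
  linear_combination he

/-- Volume below `1` forces an agreement at some `t` in `[0, 1]`. Over one period each map grows by
at most `n + 1`, which bounds the shift. -/
theorem PPMap.abs_le_of_volume_lt_one {n : ℕ} (f g : PPMap PPSet.circle (PPSet.std n)) {k : ℤ}
    (h : MeasureTheory.volume {t : ℝ | t ∈ Set.Icc (0 : ℝ) 1 ∧
      (f.toFun t : ℤ) ≠ (g.toFun t : ℤ) + k * (n + 1)} < 1) :
    |k| ≤ |(f.toFun (0 : ℝ) : ℤ) - (g.toFun (0 : ℝ) : ℤ)| + (n + 1) := by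
  obtain ⟨t, ht, he⟩ : ∃ t ∈ Set.Icc (0 : ℝ) 1,
      (f.toFun t : ℤ) = (g.toFun t : ℤ) + k * (n + 1) := by
    by_contra! hne
    have : {t : ℝ | t ∈ Set.Icc (0 : ℝ) 1 ∧ (f.toFun t : ℤ) ≠ (g.toFun t : ℤ) + k * (n + 1)}
        = Set.Icc 0 1 := by
      ext t
      exact ⟨fun h => h.1, fun h => ⟨h, hne t h⟩⟩
    rw [this, Real.volume_Icc] at h
    simp at h
  have key : ∀ f : PPMap PPSet.circle (PPSet.std n), (f.toFun (0 : ℝ) : ℤ) ≤ f.toFun t ∧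
      (f.toFun t : ℤ) ≤ f.toFun (0 : ℝ) + (n + 1) := by
    intro f
    refine ⟨f.std_mono_real ht.1, ?_⟩
    have := f.std_toFun_add_int 0 1
    rw [zero_add, Int.cast_one, one_mul] at this
    exact this ▸ f.std_mono_real ht.2
  obtain ⟨h1, h2⟩ := key f
  obtain ⟨h3, h4⟩ := key g
  have h5 : |k| ≤ |k * ((n : ℤ) + 1)| := by
    rw [abs_mul]
    exact le_mul_of_one_le_right (abs_nonneg _) ((by omega : 1 ≤ (n : ℤ) + 1).trans (le_abs_self _))
  refine h5.trans ?_
  rw [abs_le]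
  have := le_abs_self ((f.toFun (0 : ℝ) : ℤ) - (g.toFun (0 : ℝ) : ℤ))
  have := neg_abs_le ((f.toFun (0 : ℝ) : ℤ) - (g.toFun (0 : ℝ) : ℤ))
  constructor <;> linarith

/-- A disagreement at a point persists on an interval to its right, by upper semicontinuity, and so
has positive measure. Working in `[0, 1)` leaves room for that interval; periodicity does the rest.
-/
theorem PPMap.USC.eq_of_volume_eq_zero {n : ℕ} {f g : PPMap PPSet.circle (PPSet.std n)}
    (hf : f.USC) (hg : g.USC) {k : ℤ}
    (h : MeasureTheory.volume {t : ℝ | t ∈ Set.Icc (0 : ℝ) 1 ∧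
      (f.toFun t : ℤ) ≠ (g.toFun t : ℤ) + k * (n + 1)} = 0) (x : ℝ) :
    (f.toFun x : ℤ) = (g.toFun x : ℤ) + k * (n + 1) := by
  have key : ∀ x : ℝ, 0 ≤ x → x < 1 → (f.toFun x : ℤ) = (g.toFun x : ℤ) + k * (n + 1) := by
    intro x h0 h1
    by_contra hne
    obtain ⟨δ, hδ, hfx⟩ := hf.eventually_eq x
    obtain ⟨δ', hδ', hgx⟩ := hg.eventually_eq x
    set r := min (min δ δ') (1 - x)
    have hr : 0 < r := by simp [r, hδ, hδ', h1]
    have hr1 : r ≤ δ := (min_le_left _ _).trans (min_le_left _ _)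
    have hr2 : r ≤ δ' := (min_le_left _ _).trans (min_le_right _ _)
    have hr3 : r ≤ 1 - x := min_le_right _ _
    have hsub : Set.Ico x (x + r) ⊆ {t : ℝ | t ∈ Set.Icc (0 : ℝ) 1 ∧
        (f.toFun t : ℤ) ≠ (g.toFun t : ℤ) + k * (n + 1)} := by
      rintro y ⟨hy, hy'⟩
      refine ⟨⟨by linarith, by linarith⟩, ?_⟩
      rw [hfx y hy (by linarith), hgx y hy (by linarith)]
      exact hne
    have := MeasureTheory.measure_mono_null hsub h
    rw [Real.volume_Ico] at this
    simp at this
    linarith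
  have h1 := f.std_toFun_add_int (Int.fract x) ⌊x⌋
  have h2 := g.std_toFun_add_int (Int.fract x) ⌊x⌋
  rw [Int.fract_add_floor] at h1 h2
  rw [h1, h2, key _ (Int.fract_nonneg x) (Int.fract_lt_one x)]
  ring

theorem Geo.eq_of_edist_eq_zero {n : ℕ} {c d : Geo (PPSet.std n)} (h : edist c d = 0) : c = d := by
  obtain ⟨f, hf, hfu⟩ := c.2
  obtain ⟨g, hg, hgu⟩ := d.2
  let D : ℤ → ENNReal := fun k => MeasureTheory.volume {t : ℝ | t ∈ Set.Icc (0 : ℝ) 1 ∧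
    (f.toFun t : ℤ) ≠ (g.toFun t : ℤ) + k * (n + 1)}
  obtain ⟨k, hk⟩ : ∃ k, D k = 0 := by
    by_contra! hD
    let M := |(f.toFun (0 : ℝ) : ℤ) - (g.toFun (0 : ℝ) : ℤ)| + (n + 1)
    have hM : 0 ≤ M := by positivity
    obtain ⟨k₀, -, hk₀⟩ := Finset.exists_min_image (Finset.Icc (-M) M) D
      ⟨0, Finset.mem_Icc.2 ⟨by linarith, hM⟩⟩
    -- The bound `1` confines `k` to the finite range over which `k₀` minimizes `D`; the bound `D
    -- k₀` then contradicts minimality. So the infimum `0` is attained.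
    obtain ⟨k, hk⟩ := Geo.exists_volume_lt hf hg (ε := min (D k₀) 1)
      (by rw [h]; exact lt_min (pos_iff_ne_zero.2 (hD k₀)) one_pos)
    have h1 := PPMap.abs_le_of_volume_lt_one f g (hk.trans_le (min_le_right _ _))
    exact absurd (hk₀ k (Finset.mem_Icc.2 (abs_le.1 h1)))
      (not_le.2 (hk.trans_le (min_le_left _ _)))
  refine Subtype.ext ?_
  rw [← hf, ← hg]
  refine (Quotient.sound (s := PPMap.setoid _ _) ⟨0, fun _ => k, fun x => ?_⟩).symm
  rw [zero_vadd]
  exact hfu.eq_of_volume_eq_zero hgu hk x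

instance Geo.t2Space_std (n : ℕ) : T2Space (Geo (PPSet.std n)) := by
  have : T0Space (Geo (PPSet.std n)) := (t0Space_iff_inseparable _).2 fun c d h =>
    Geo.eq_of_edist_eq_zero (EMetric.inseparable_iff.1 h)
  infer_instance

/-! ### Finiteness and countability of morphism sets -/

theorem PPMap.ext_std {n : ℕ} {P : PPSet.{u}} {f g : PPMap (PPSet.std n) P}
    (h : ∀ i : Fin (n + 1), f.toFun ((i : ℕ) : ℤ) = g.toFun ((i : ℕ) : ℤ)) : f = g := by
  ext (x : ℤ)
  have hn : (0 : ℤ) < (n : ℤ) + 1 := by positivity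
  have h0 := Int.emod_nonneg x hn.ne'
  have h1 := Int.emod_lt_of_pos x hn
  have key : ∀ f : PPMap (PPSet.std n) P, f.toFun x =
      ((x / ((n : ℤ) + 1)) • (1 : Fin P.deg → ℤ)) +ᵥ f.toFun (x % ((n : ℤ) + 1)) := by
    intro f
    rw [← f.map_zsmul_one]
    congr 1
    change x = x % ((n : ℤ) + 1) + (x / ((n : ℤ) + 1) * 1) * ((n : ℤ) + 1)
    rw [mul_one, Int.emod_add_ediv_mul]
  rw [key f, key g]
  have := h ⟨(x % ((n : ℤ) + 1)).toNat, by omega⟩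
  simp only [Int.toNat_of_nonneg h0] at this
  rw [this]

/-- A shift of the target brings the value at `0` into `[0, n]`. Monotonicity and periodicity then
bound the values on `0, …, N`, which determine the map. -/
instance PPHom.finite_std (N n : ℕ) : Finite (PPHom (PPSet.std N) (PPSet.std n)) := by
  have key : ∀ h : PPHom (PPSet.std N) (PPSet.std n), ∃ f : PPMap (PPSet.std N) (PPSet.std n),
      PPHom.mk f = h ∧ ∀ i : Fin (N + 1),
        (f.toFun ((i : ℕ) : ℤ) : ℤ) ∈ Set.Icc (0 : ℤ) (2 * (n + 1)) := by
    intro h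
    induction h using Quotient.inductionOn with | h f => ?_
    let k : ℤ := (f.toFun (0 : ℤ) : ℤ) / ((n : ℤ) + 1)
    let b : Fin (PPSet.std n).deg → ℤ := fun _ => -k
    let g : PPMap (PPSet.std N) (PPSet.std n) :=
      { toFun := fun x => ((f.toFun x : ℤ) + (-k) * ((n : ℤ) + 1) : ℤ)
        mono := fun x y h => (PPSet.std n).shift_mono b _ _ (f.mono _ _ h)
        map_one := fun x => by
          have h : (f.toFun (x + 1 * ((N : ℤ) + 1) : ℤ) : ℤ) =
            (f.toFun x : ℤ) + 1 * ((n : ℤ) + 1) := f.map_one x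
          change (f.toFun (x + 1 * ((N : ℤ) + 1) : ℤ) : ℤ) + (-k) * ((n : ℤ) + 1) =
            (f.toFun x : ℤ) + (-k) * ((n : ℤ) + 1) + 1 * ((n : ℤ) + 1)
          rw [h]
          ring }
    refine ⟨g, (Quotient.sound (s := PPMap.setoid _ _) ⟨0, b, fun x => by rw [zero_vadd]; rfl⟩).symm,
      fun i => ?_⟩
    have hn : (0 : ℤ) < (n : ℤ) + 1 := by positivity
    have h0 : (g.toFun (0 : ℤ) : ℤ) = (f.toFun (0 : ℤ) : ℤ) % ((n : ℤ) + 1) := by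
      change (f.toFun (0 : ℤ) : ℤ) + (-k) * ((n : ℤ) + 1) = _
      rw [Int.emod_def]
      ring
    have h1 := Int.emod_nonneg (f.toFun (0 : ℤ) : ℤ) hn.ne'
    have h2 := Int.emod_lt_of_pos (f.toFun (0 : ℤ) : ℤ) hn
    have h3 : (g.toFun (0 + 1 * ((N : ℤ) + 1) : ℤ) : ℤ) =
        (g.toFun (0 : ℤ) : ℤ) + 1 * ((n : ℤ) + 1) :=
      g.map_one (0 : ℤ)
    have h4 : (g.toFun (0 : ℤ) : ℤ) ≤ g.toFun ((i : ℕ) : ℤ) :=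
      g.mono (0 : ℤ) ((i : ℕ) : ℤ) (show (0 : ℤ) ≤ ((i : ℕ) : ℤ) by positivity)
    have h5 : (g.toFun ((i : ℕ) : ℤ) : ℤ) ≤ g.toFun (0 + 1 * ((N : ℤ) + 1) : ℤ) :=
      g.mono ((i : ℕ) : ℤ) (0 + 1 * ((N : ℤ) + 1) : ℤ)
        (show ((i : ℕ) : ℤ) ≤ 0 + 1 * ((N : ℤ) + 1) by omega)
    constructor <;> linarith
  choose F hF hF' using key
  refine Finite.of_injective (β := Fin (N + 1) → Set.Icc (0 : ℤ) (2 * (n + 1)))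
    (fun h i => ⟨_, hF' h i⟩) fun h h' he => ?_
  rw [← hF h, ← hF h', PPMap.ext_std fun i => congrArg Subtype.val (congrFun he i)]

theorem PPSet.IsCompact.countable {P : PPSet.{u}} (hP : P.IsCompact) : Countable P.carrier := by
  have : Finite (AddAction.orbitRel.Quotient (Fin P.deg → ℤ) P.carrier) := hP
  refine Function.Surjective.countable (α := AddAction.orbitRel.Quotient (Fin P.deg → ℤ) P.carrier ×
    (Fin P.deg → ℤ)) (f := fun q => q.2 +ᵥ Quotient.out q.1) fun x => ?_
  obtain ⟨a, ha⟩ := AddAction.orbitRel_apply.1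
    (Quotient.mk_out (s := AddAction.orbitRel (Fin P.deg → ℤ) P.carrier) x)
  exact ⟨(Quotient.mk (AddAction.orbitRel (Fin P.deg → ℤ) P.carrier) x, -a), by
    simp only [← ha, neg_vadd_vadd]⟩

theorem PPSet.IsCompact.countable_hom {P : PPSet.{u}} (hP : P.IsCompact) (n : ℕ) :
    Countable (PPHom (PPSet.std n) P) := by
  have := hP.countable
  have : Countable (PPMap (PPSet.std n) P) := Function.Injective.countable
    (f := fun f (i : Fin (n + 1)) => f.toFun ((i : ℕ) : ℤ))
    fun f g h => PPMap.ext_std fun i => congrFun h i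
  exact inferInstanceAs (Countable (Quotient _))

/-! ### The kernel of the realization and the comparison map -/

open scoped CategoryTheory

theorem PPHom.comp_assoc {R : PPSet.{u}} {P Q : PPSet.{v}} {S : PPSet.{w}}
    (hP : P.deg = 1) (hQ : Q.deg = 1) (f : PPHom R P) (g : PPHom P Q) (h : PPHom Q S) :
    PPHom.comp hP f (PPHom.comp hQ g h) = PPHom.comp hQ (PPHom.comp hP f g) h := by
  induction f using Quotient.inductionOn
  induction g using Quotient.inductionOn
  induction h using Quotient.inductionOn
  rfl

namespace CyclicSet.Realization

/-- The point of `‖C‖` given by an element of `C([[n]])` and a point of `‖[[n]]‖`. -/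
def mk {C : CyclicSet.{u}} {a : CycCat} (x : C.obj (Opposite.op a)) (c : Geo a.pp) :
    C.Realization := Quot.mk _ ⟨⟨a, x⟩, c⟩

theorem mk_map {C : CyclicSet.{u}} {a b : CycCat} (θ : a ⟶ b) (x : C.obj (Opposite.op b))
    (c : Geo a.pp) : mk (C.map θ.op x) c = mk x (Geo.map rfl θ c) :=
  Quot.sound (.glue θ x c)

theorem continuous_mk {C : CyclicSet.{u}} {a : CycCat} (x : C.obj (Opposite.op a)) :
    Continuous (mk x : Geo a.pp → C.Realization) :=
  continuous_quot_mk.comp (continuous_sigmaMk (σ := fun p : (Σ a : CycCat, C.obj (Opposite.op a)) =>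
    Geo p.1.pp) (i := ⟨a, x⟩))

theorem continuous_map {C D : CyclicSet.{u}} (φ : C ⟶ D) : Continuous (map φ) :=
  isQuotientMap_quot_mk.continuous_iff.2 (continuous_sigma fun p =>
    continuous_mk (C := D) (φ.app _ p.2))

theorem map_vadd {C D : CyclicSet.{u}} (φ : C ⟶ D) (s : UnitAddCircle) (z : C.Realization) :
    map φ (s +ᵥ z) = s +ᵥ map φ z := by
  obtain ⟨z⟩ := z
  rfl

/-- The map `‖𝒞(P)‖ → Hom(S¹, P)` given by composition. -/
noncomputable def eval {P : PPSet.{u}} : P.cyclic.Realization → PPHom PPSet.circle P :=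
  Quot.lift (fun z => PPHom.comp rfl z.2.1 z.1.2) (by
    rintro _ _ ⟨θ, x, c⟩
    exact PPHom.comp_assoc _ _ _ _ _)

/-- The equivalence relation generated by the gluings is reduced to a single span from the fixed
object `[[a.n + b.n + 1]]`: equal points have equal composites `S¹ → P`, and the common refinement
detects this equality. -/
theorem mk_eq_mk_iff {P : PPSet.{u}} {a b : CycCat} (x : P.cyclic.obj (Opposite.op a))
    (y : P.cyclic.obj (Opposite.op b)) (c : Geo a.pp) (d : Geo b.pp) :
    mk x c = mk y d ↔ ∃ (θ : (⟨a.n + b.n + 1⟩ : CycCat) ⟶ a) (θ' : (⟨a.n + b.n + 1⟩ : CycCat) ⟶ b),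
      P.cyclic.map θ.op x = P.cyclic.map θ'.op y ∧
        ∃ s, Geo.map rfl θ s = c ∧ Geo.map rfl θ' s = d := by
  constructor
  · intro h
    obtain ⟨s, θ, θ', h1, h2, h3⟩ := Geo.exists_common_refinement c d
    exact ⟨θ, θ', h3 P x y (congrArg eval h), s, h1, h2⟩
  · rintro ⟨θ, θ', h, s, rfl, rfl⟩
    rw [← mk_map, ← mk_map, h]

theorem isClosed_kernel (P : PPSet.{u}) :
    IsClosed {p : P.cyclic.PreRealization × P.cyclic.PreRealization |
      Quot.mk P.cyclic.Rel p.1 = Quot.mk P.cyclic.Rel p.2} := by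
  rw [← isOpen_compl_iff]
  refine continuous_Prop.1 (continuous_sigma_prod_sigma fun i j => continuous_Prop.2 ?_)
  refine (isOpen_compl_iff (s := {p : Geo i.1.pp × Geo j.1.pp | mk i.2 p.1 = mk j.2 p.2})).2 ?_
  simp only [mk_eq_mk_iff, Set.ofPred_exists, Set.ofPred_and]
  have h1 : Finite ((⟨i.1.n + j.1.n + 1⟩ : CycCat) ⟶ i.1) := PPHom.finite_std _ _
  have h2 : Finite ((⟨i.1.n + j.1.n + 1⟩ : CycCat) ⟶ j.1) := PPHom.finite_std _ _
  refine isClosed_iUnion_of_finite fun θ => isClosed_iUnion_of_finite fun θ' =>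
    isClosed_const.inter ?_
  -- For fixed `θ` and `θ'`, the related pairs form the image of the compact `‖[[N]]‖` in a
  -- Hausdorff space, hence a closed set.
  have hc := isCompact_range ((Geo.continuous_map rfl θ).prodMk (Geo.continuous_map rfl θ'))
  convert hc.isClosed using 1
  ext p
  simp [Prod.ext_iff]

/-- Compactness of `P` and `Q` enters here: it leaves countably many simplices, so the disjoint
unions of compact spaces are σ-compact. -/
theorem isQuotientMap_prodMap {P Q : PPSet.{u}} (hP : P.IsCompact) (hQ : Q.IsCompact) :
    Topology.IsQuotientMap (Prod.map (Quot.mk P.cyclic.Rel) (Quot.mk Q.cyclic.Rel)) := by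
  have key : ∀ {P : PPSet.{u}}, P.IsCompact → LocallyCompactSpace P.cyclic.PreRealization ∧
      SigmaCompactSpace P.cyclic.PreRealization := by
    intro P hP
    have h1 : ∀ a : CycCat, Countable (P.cyclic.obj (Opposite.op a)) := fun a =>
      hP.countable_hom a.n
    have h2 : Countable CycCat := Function.Injective.countable (f := CycCat.n) fun a b h => by
      cases a; cases b; exact congrArg _ h
    exact ⟨Sigma.locallyCompactSpace, inferInstance⟩
  obtain ⟨h1, h2⟩ := key hP
  obtain ⟨h3, h4⟩ := key hQ
  exact isQuotientMap_quot_mk.prodMap_of_isClosed_kernel isQuotientMap_quot_mk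
    (isClosed_kernel P) (isClosed_kernel Q)

/-- The map `‖C × D‖ → ‖C‖ × ‖D‖` induced by the two projections. -/
noncomputable def prodComparison (C D : CyclicSet.{u}) (z : (C.prod D).Realization) :
    C.Realization × D.Realization :=
  (map (CyclicSet.fst C D) z, map (CyclicSet.snd C D) z)

theorem prodComparison_mk_map {C D : CyclicSet.{u}} {a b e : CycCat} (θ : e ⟶ a) (θ' : e ⟶ b)
    (x : C.obj (Opposite.op a)) (y : D.obj (Opposite.op b)) (s : Geo e.pp) :
    prodComparison C D (mk (C := C.prod D) (C.map θ.op x, D.map θ'.op y) s) =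
      (mk x (Geo.map rfl θ s), mk y (Geo.map rfl θ' s)) := by
  rw [← mk_map, ← mk_map]
  rfl

theorem continuous_prodComparison (C D : CyclicSet.{u}) : Continuous (prodComparison C D) :=
  (continuous_map _).prodMk (continuous_map _)

theorem bijective_prodComparison (P Q : PPSet.{u}) :
    Function.Bijective (prodComparison P.cyclic Q.cyclic) := by
  constructor
  · rintro ⟨⟨a, x, x'⟩, c⟩ ⟨⟨b, y, y'⟩, d⟩ h
    -- The refinement depends only on `c` and `d`, so the same `θ` and `θ'` serve both the `P` and
    -- the `Q` components.
    obtain ⟨s, θ, θ', rfl, rfl, h3⟩ := Geo.exists_common_refinement c d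
    have h1 := h3 P x y (congrArg
      (fun z : P.cyclic.Realization × Q.cyclic.Realization => eval z.1) h)
    have h2 := h3 Q x' y' (congrArg
      (fun z : P.cyclic.Realization × Q.cyclic.Realization => eval z.2) h)
    change mk (C := P.cyclic.prod Q.cyclic) (x, x') _ = mk (C := P.cyclic.prod Q.cyclic) (y, y') _
    have hm := mk_map (C := P.cyclic.prod Q.cyclic) (a := ⟨a.n + b.n + 1⟩) (b := a) θ (x, x') s
    have hm' := mk_map (C := P.cyclic.prod Q.cyclic) (a := ⟨a.n + b.n + 1⟩) (b := b) θ' (y, y') s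
    rw [← hm, ← hm']
    exact congrArg (fun z => mk (C := P.cyclic.prod Q.cyclic) (a := ⟨a.n + b.n + 1⟩) z s)
      (Prod.ext h1 h2)
  · rintro ⟨⟨⟨a, x⟩, c⟩, ⟨⟨b, y⟩, d⟩⟩
    obtain ⟨s, θ, θ', rfl, rfl, -⟩ := Geo.exists_common_refinement.{0} c d
    exact ⟨_, prodComparison_mk_map (e := ⟨a.n + b.n + 1⟩) θ θ' x y s⟩

theorem isHomeomorph_prodComparison {P Q : PPSet.{u}} (hP : P.IsCompact) (hQ : Q.IsCompact) :
    IsHomeomorph (prodComparison P.cyclic Q.cyclic) := by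
  let e := Equiv.ofBijective _ (bijective_prodComparison P Q)
  suffices h : Continuous e.symm from
    (Homeomorph.mk e (continuous_prodComparison _ _) h).isHomeomorph
  refine (isQuotientMap_prodMap hP hQ).continuous_iff.2
    (continuous_sigma_prod_sigma fun i j => ?_)
  let N : CycCat := ⟨i.1.n + j.1.n + 1⟩
  have h1 : Finite (N ⟶ i.1) := PPHom.finite_std _ _
  have h2 : Finite (N ⟶ j.1) := PPHom.finite_std _ _
  let F : (Σ _ : (N ⟶ i.1) × (N ⟶ j.1), Geo N.pp) → Geo i.1.pp × Geo j.1.pp := fun z =>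
    (Geo.map rfl z.1.1 z.2, Geo.map rfl z.1.2 z.2)
  have hF : Continuous F := continuous_sigma fun θ =>
    (Geo.continuous_map rfl θ.1).prodMk (Geo.continuous_map rfl θ.2)
  have hFs : Function.Surjective F := by
    rintro ⟨c, d⟩
    obtain ⟨s, θ, θ', h1, h2, -⟩ := Geo.exists_common_refinement.{0} c d
    exact ⟨⟨(θ, θ'), s⟩, Prod.ext h1 h2⟩
  -- The source of `F` is a finite disjoint union of compact spaces and its target is Hausdorff, so
  -- `F` is a closed surjection and continuity can be tested on each summand.
  refine (hF.isClosedMap.isQuotientMap hF hFs).continuous_iff.2 (continuous_sigma fun θ => ?_)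
  refine (continuous_mk (C := P.cyclic.prod Q.cyclic)
    (P.cyclic.map θ.1.op i.2, Q.cyclic.map θ.2.op j.2)).congr fun s => ?_
  exact (e.symm_apply_eq.2 (prodComparison_mk_map θ.1 θ.2 i.2 j.2 s).symm).symm

end CyclicSet.Realization

theorem mainTheorem4 (P Q : PPSet.{u}) (hP : P.IsCompact) (hQ : Q.IsCompact) :
    ∃ Φ : (P.cyclic.prod Q.cyclic).Realization ≃ₜ P.cyclic.Realization × Q.cyclic.Realization,
      (∀ z, Φ z = (CyclicSet.Realization.map (CyclicSet.fst P.cyclic Q.cyclic) z,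
        CyclicSet.Realization.map (CyclicSet.snd P.cyclic Q.cyclic) z)) ∧
      ∀ (s : UnitAddCircle) z, Φ (s +ᵥ z) = (s +ᵥ (Φ z).1, s +ᵥ (Φ z).2) := by
  refine ⟨(CyclicSet.Realization.isHomeomorph_prodComparison hP hQ).homeomorph, fun z => rfl,
    fun s z => ?_⟩
  exact Prod.ext (CyclicSet.Realization.map_vadd _ s z) (CyclicSet.Realization.map_vadd _ s z)
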